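/- For an entire function $g:\mathbb{C}\to\mathbb{C}$ let $M_g(r)=\max_{|z|\le r}|g(z)|$. Its order is $\operatorname{ord} g=\limsup_{r\to\infty}\frac{\ln\ln M_g(r)}{\ln r}\in[0,\infty]$ (with the convention $\operatorname{ord} g=0$ for constant $g$, including $g\equiv 0$). If its order $\sigma$ satisfies $0<\sigma<\infty$, its type is $\operatorname{type} g=\limsup_{r\to\infty}\frac{\ln M_g(r)}{r^{\sigma}}\in[0,\infty]$. **Theorem 5.** Let $F(t,z)$, $(t,z)\in\mathbb{C}^2$, be an entire solution of the heat equation $\partial_tF=\partial_z^2F$; that is, $F$ is entire in $z$ for every fixed $t$, entire in $t$ for every fixed $z$, and the equation holds everywhere on $\mathbb{C}^2$. Let $\rho$ and $\tau$ be its $z$-order and $z$-type, i.e. the order and the type of $F(t_0,\cdot)$ for some (arbitrary) $t_0\in\mathbb{C}$, and suppose that $0<\rho<2$. For $z\in\mathbb{C}$ let $\rho_{t,0}(z)$ and $\rho_{t,1}(z)$ be the orders of the entire functions $t\mapsto F(t,z)$ and $t\mapsto\partial_zF(t,z)$. Then $\rho_t:=\max\{\rho_{t,0}(z),\rho_{t,1}(z)\}$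 does not depend on $z$ and equals $\frac{\rho}{2-\rho}\in(0,\infty)$, and the sets $$\mathcal{E}_0=\{z\in\mathbb{C}:\rho_{t,0}(z)=\rho_t\},\qquad \mathcal{E}_1=\{z\in\mathbb{C}:\rho_{t,1}(z)=\rho_t\}$$ have full Lebesgue measure in $\mathbb{C}$. Let $\tau_{t,0}(z)$, $z\in\mathcal{E}_0$, and $\tau_{t,1}(z)$, $z\in\mathcal{E}_1$, be the types of $t\mapsto F(t,z)$ and $t\mapsto\partial_zF(t,z)$. Then: (i) The quantity $\tau_t:=\max\{\tau_{t,0}(z),\tau_{t,1}(z)\}\in[0,\infty]$ is the same for all $z\in\mathcal{E}_0\cap\mathcal{E}_1$, and $$\tau_t=\Bigl(1-\frac{\rho}{2}\Bigr)(2\rho)^{\frac{\rho}{2-\rho}}\,\tau^{\frac{2}{2-\rho}}$$ (with $\infty^{2/(2-\rho)}=\infty$). In particular, $\tau_t=0$ if and only if $\tau=0$, and $\tau_t=\infty$ if and only if $\tau=\infty$. (ii) If $\tau_t<\infty$, then $\tau_{t,0}(z)=\tau_t$ for almost every $z\in\mathbb{C}$ and $\tau_{t,1}(z)=\tau_t$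 for almost every $z\in\mathbb{C}$. -/

import Mathlib

open scoped ENNReal

noncomputable section

namespace CaloricGrowth

/-- The maximum modulus `M_g(r) = sup_{|z| ≤ r} |g z|`. -/
def maxModulus (g : ℂ → ℂ) (r : ℝ) : ℝ :=
  sSup ((fun z : ℂ => ‖g z‖) '' Metric.closedBall 0 r)

/-- The order `limsup_{r → ∞} ln ln M_g(r) / ln r ∈ [0, ∞]` of an entire function `g`.
For nonconstant `g` the quotient is nonnegative for large `r`, so that `ENNReal.ofReal` loses
nothing; for constant `g` (also for `g = 0`) the value is the conventional one, `0`. -/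
def entireOrder (g : ℂ → ℂ) : ℝ≥0∞ :=
  Filter.limsup
    (fun r : ℝ => ENNReal.ofReal (Real.log (Real.log (maxModulus g r)) / Real.log r))
    Filter.atTop

/-- The type `limsup_{r → ∞} ln M_g(r) / r ^ ρ ∈ [0, ∞]` of an entire function `g` whose order
`ρ` satisfies `0 < ρ < ∞` (for `ρ = 0` and `ρ = ∞` the type is not defined and the value here has
no meaning). -/
def entireType (g : ℂ → ℂ) : ℝ≥0∞ :=
  Filter.limsup
    (fun r : ℝ => ENNReal.ofReal (Real.log (maxModulus g r) / r ^ (entireOrder g).toReal))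
    Filter.atTop

/-- `F(t, z)` is an entire solution of the heat equation `∂_t F = ∂_z² F`: it is entire in each
variable separately and the equation holds at every point of `ℂ²`. -/
structure IsEntireCaloric (F : ℂ → ℂ → ℂ) : Prop where
  entire_z : ∀ t : ℂ, Differentiable ℂ (fun z : ℂ => F t z)
  entire_t : ∀ z : ℂ, Differentiable ℂ (fun t : ℂ => F t z)
  heat : ∀ t z : ℂ, deriv (fun s : ℂ => F s z) t = iteratedDeriv 2 (fun w : ℂ => F t w) z

/-- The function `t ↦ F(t, z)`. -/
def tSlice (F : ℂ → ℂ → ℂ) (z : ℂ) : ℂ → ℂ := fun t => F t z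

/-- The function `t ↦ ∂_z F(t, z)`. -/
def tSliceDz (F : ℂ → ℂ → ℂ) (z : ℂ) : ℂ → ℂ := fun t => deriv (fun w : ℂ => F t w) z

/-- `max {ρ_{t,0}(z), ρ_{t,1}(z)}`, where `ρ_{t,0}(z)` and `ρ_{t,1}(z)` are the orders of
`F(·, z)` and `∂_z F(·, z)`. -/
def caloricTOrder (F : ℂ → ℂ → ℂ) (z : ℂ) : ℝ≥0∞ :=
  max (entireOrder (tSlice F z)) (entireOrder (tSliceDz F z))

/-- The set of all `z` for which the order of `F(·, z)` is maximal. -/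
def E0 (F : ℂ → ℂ → ℂ) : Set ℂ := {z | entireOrder (tSlice F z) = caloricTOrder F z}

/-- The set of all `z` for which the order of `∂_z F(·, z)` is maximal. -/
def E1 (F : ℂ → ℂ → ℂ) : Set ℂ := {z | entireOrder (tSliceDz F z) = caloricTOrder F z}

end CaloricGrowth

end

open scoped ENNReal
open Filter Topology Metric MeasureTheory

noncomputable section

namespace CaloricGrowth

/-! The heat equation gives `∂_t^k ∂_z^p F = ∂_z^(2k+p) F`. The Taylor coefficients in `t` of `F(·,
z)` and `∂_z F(·, z)` are therefore governed by the even and the odd `z`-derivatives of `F(t₀, ·)`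
at `z`. An entire function has growth at most of order `σ` and type `T` exactly when its `n`-th
derivatives at one (any) point are `O(μ^n n^(n(1-1/σ)))` for every `μ` above `derivRate σ T`
(`typeLE_iff_seqLE`). Passing from `n` to `2k` doubles the exponent `1 - 1/σ`, which sends order `σ`
to `σ/(2-σ)`, and sends `T` to `timeType σ T`. Hence `F(t₀, ·)` obeys a growth bound iff both time
slices obey the transferred one (`IsEntireCaloric.typeLE_iff`); this yields the order and the
maximum of the types.

For the statements almost everywhere, suppose one slice grows too slowly on a set of positive area.
Its `z`-derivatives of a single parity are then too small there, with uniform constants on a smaller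
set of positive area. The two-constants inequality `exists_two_constants` interpolates this with the
true growth bound and improves the latter strictly on the unit disc. Cauchy's estimate recovers the
other parity (`typeLE_of_even_bound`), so `F(t₀, ·)` would have smaller order or type than assumed.

Separate holomorphy does not give the derivative identity at once: two Baire arguments and the
identity theorem first show that `F` is locally bounded (`IsEntireCaloric.locallyBounded`). -/

/-! ### Order and type as exponential growth bounds -/

/-- `g` grows at most like `exp (B |z| ^ σ)`. -/
def ExpBound (g : ℂ → ℂ) (σ B : ℝ) : Prop :=
  ∃ C : ℝ, ∀ z, ‖g z‖ ≤ C * Real.exp (B * ‖z‖ ^ σ)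

/-- `g` has growth at most of order `σ` and type `T`. -/
def TypeLE (g : ℂ → ℂ) (σ T : ℝ) : Prop := ∀ B > T, ExpBound g σ B

lemma ExpBound.exists_one_le {g : ℂ → ℂ} {σ B : ℝ} (h : ExpBound g σ B) :
    ∃ C : ℝ, 1 ≤ C ∧ ∀ z, ‖g z‖ ≤ C * Real.exp (B * ‖z‖ ^ σ) := by
  obtain ⟨C, hC⟩ := h
  exact ⟨max C 1, le_max_right _ _, fun z => (hC z).trans (by gcongr; exact le_max_left _ _)⟩

lemma norm_le_maxModulus {g : ℂ → ℂ} (hg : Continuous g) {r : ℝ} {z : ℂ} (hz : ‖z‖ ≤ r) :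
    ‖g z‖ ≤ maxModulus g r := by
  refine le_csSup ?_ ⟨z, by simpa using hz, rfl⟩
  exact ((isCompact_closedBall (0 : ℂ) r).image hg.norm).bddAbove

lemma maxModulus_le {g : ℂ → ℂ} {r c : ℝ} (hr : 0 ≤ r) (h : ∀ z, ‖z‖ ≤ r → ‖g z‖ ≤ c) :
    maxModulus g r ≤ c := by
  refine csSup_le ⟨‖g 0‖, 0, by simpa using hr, rfl⟩ ?_
  rintro _ ⟨z, hz, rfl⟩
  exact h z (by simpa using hz)

lemma maxModulus_nonneg {g : ℂ → ℂ} {r : ℝ} : 0 ≤ maxModulus g r := by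
  refine Real.sSup_nonneg ?_
  rintro _ ⟨z, hz, rfl⟩
  exact norm_nonneg _

lemma maxModulus_le_of_bound {g : ℂ → ℂ} {σ B C r : ℝ} (hσ : 0 ≤ σ) (hB : 0 ≤ B) (hC : 1 ≤ C)
    (hr : 0 ≤ r) (h : ∀ z, ‖g z‖ ≤ C * Real.exp (B * ‖z‖ ^ σ)) :
    maxModulus g r ≤ C * Real.exp (B * r ^ σ) := by
  refine maxModulus_le hr fun z hz => (h z).trans ?_
  have := Real.rpow_le_rpow (norm_nonneg z) hz hσ
  gcongr

lemma expBound_of_eventually {g : ℂ → ℂ} (hg : Continuous g) {σ B : ℝ} (hB : 0 ≤ B)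
    (h : ∀ᶠ r in atTop, maxModulus g r ≤ Real.exp (B * r ^ σ)) : ExpBound g σ B := by
  obtain ⟨r₀, hr₀⟩ := eventually_atTop.1 h
  refine ⟨max 1 (maxModulus g r₀), fun z => ?_⟩
  have h1 : 1 ≤ Real.exp (B * ‖z‖ ^ σ) := Real.one_le_exp (by positivity)
  rcases le_total r₀ ‖z‖ with hz | hz
  · calc ‖g z‖ ≤ maxModulus g ‖z‖ := norm_le_maxModulus hg le_rfl
      _ ≤ Real.exp (B * ‖z‖ ^ σ) := hr₀ _ hz
      _ ≤ _ := le_mul_of_one_le_left (by positivity) (le_max_left _ _)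
  · calc ‖g z‖ ≤ maxModulus g r₀ := norm_le_maxModulus hg hz
      _ ≤ max 1 (maxModulus g r₀) := le_max_right _ _
      _ ≤ _ := le_mul_of_one_le_right (by positivity) h1

lemma le_exp_log_of_nonneg {x : ℝ} (hx : 0 ≤ x) {y : ℝ} (hy : Real.log x ≤ y) : x ≤ Real.exp y := by
  rcases hx.eq_or_lt with rfl | hx
  · positivity
  · exact (Real.log_le_iff_le_exp hx).1 hy

lemma typeLE_zero_of_entireOrder_le {g : ℂ → ℂ} (hg : Continuous g) {s σ : ℝ} (hs : 0 ≤ s)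
    (hσ : s < σ) (h : entireOrder g ≤ ENNReal.ofReal s) : TypeLE g σ 0 := by
  intro B hB
  obtain ⟨σ', h1, h2⟩ := exists_between hσ
  have h3 := eventually_lt_of_limsup_lt
    (h.trans_lt ((ENNReal.ofReal_lt_ofReal_iff (hs.trans_lt h1)).2 h1))
  have h4 : ∀ᶠ r : ℝ in atTop, B⁻¹ ≤ r ^ (σ - σ') :=
    (tendsto_rpow_atTop (sub_pos.2 h2)).eventually_ge_atTop _
  refine expBound_of_eventually hg hB.le ?_
  filter_upwards [h3, h4, eventually_gt_atTop 1] with r h3 h4 hr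
  have hlog : 0 < Real.log r := Real.log_pos hr
  have h5 := (div_lt_iff₀ hlog).1 ((ENNReal.ofReal_lt_ofReal_iff (hs.trans_lt h1)).1 h3)
  refine le_exp_log_of_nonneg maxModulus_nonneg ?_
  have hr0 : 0 < r := by linarith
  -- If `log M ≤ 0`, the double logarithm carries no information, but the bound is trivial.
  have h6 : Real.log (maxModulus g r) ≤ r ^ σ' := by
    rcases le_or_gt (Real.log (maxModulus g r)) 0 with h0 | h0
    · exact h0.trans (by positivity)
    · rw [← Real.log_le_log_iff h0 (by positivity), Real.log_rpow hr0]
      exact h5.le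
  calc _ ≤ r ^ σ' := h6
    _ = B * B⁻¹ * r ^ σ' := by field_simp
    _ ≤ B * r ^ (σ - σ') * r ^ σ' := by gcongr
    _ = B * r ^ σ := by rw [mul_assoc, ← Real.rpow_add hr0, sub_add_cancel]

lemma ENNReal_le_ofReal_of_forall_gt {a : ℝ≥0∞} {s : ℝ}
    (h : ∀ σ > s, a ≤ ENNReal.ofReal σ) : a ≤ ENNReal.ofReal s := by
  have : Tendsto (fun σ : ℝ => ENNReal.ofReal σ) (𝓝[>] s) (𝓝 (ENNReal.ofReal s)) :=
    (ENNReal.continuous_ofReal.tendsto s).mono_left nhdsWithin_le_nhds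
  exact ge_of_tendsto this (by filter_upwards [self_mem_nhdsWithin] with σ hσ using h σ hσ)

lemma entireOrder_le_of_typeLE {g : ℂ → ℂ} (hg : Differentiable ℂ g) {s : ℝ} (hs : 0 ≤ s)
    (h : ∀ σ > s, TypeLE g σ 0) : entireOrder g ≤ ENNReal.ofReal s := by
  refine ENNReal_le_ofReal_of_forall_gt fun σ hσ => ?_
  refine limsup_le_of_le (by isBoundedDefault) ?_
  suffices H : ∀ᶠ r in atTop, Real.log (Real.log (maxModulus g r)) / Real.log r ≤ σ by
    filter_upwards [H] with r hr using ENNReal.ofReal_le_ofReal hr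
  -- By Liouville a bounded function is constant, and its quotient tends to `0`. Otherwise `log M`
  -- is eventually positive; any threshold above `1` would serve.
  by_cases hbd : ∀ z, ‖g z‖ ≤ 3
  · have hconst : ∀ z, g z = g 0 := fun z =>
      hg.apply_eq_apply_of_bounded (isBounded_iff_forall_norm_le.2 ⟨3, by
        rintro _ ⟨z, rfl⟩; exact hbd z⟩) z 0
    have hM : ∀ r ≥ 0, maxModulus g r = ‖g 0‖ := fun r hr =>
      le_antisymm (maxModulus_le hr fun z _ => by rw [hconst z])
        (norm_le_maxModulus hg.continuous (by simpa using hr))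
    have : Tendsto (fun r => Real.log (Real.log ‖g 0‖) / Real.log r) atTop (𝓝 0) :=
      Real.tendsto_log_atTop.const_div_atTop _
    filter_upwards [this.eventually_le_const (hs.trans_lt hσ), eventually_ge_atTop 0] with r h1 h2
    rwa [hM r h2]
  · push Not at hbd
    obtain ⟨z₀, hz₀⟩ := hbd
    obtain ⟨σ', h1, h2⟩ := exists_between hσ
    have hσ'0 : 0 < σ' := hs.trans_lt h1
    obtain ⟨C, hC1, hC⟩ := (h σ' h1 1 one_pos).exists_one_le
    have e1 : ∀ᶠ r : ℝ in atTop, Real.log C ≤ r ^ σ' :=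
      (tendsto_rpow_atTop hσ'0).eventually_ge_atTop _
    have e2 : ∀ᶠ r : ℝ in atTop, Real.log 2 / (σ - σ') ≤ Real.log r :=
      Real.tendsto_log_atTop.eventually_ge_atTop _
    filter_upwards [e1, e2, eventually_gt_atTop 1, eventually_ge_atTop ‖z₀‖] with r e1 e2 hr hrz
    have hr0 : 0 < r := by linarith
    have hlog : 0 < Real.log r := Real.log_pos hr
    have hM3 : 3 < maxModulus g r := hz₀.trans_le (norm_le_maxModulus hg.continuous hrz)
    have hlM : 0 < Real.log (maxModulus g r) := Real.log_pos (by linarith)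
    have hle : Real.log (maxModulus g r) ≤ 2 * r ^ σ' := by
      have := maxModulus_le_of_bound hσ'0.le zero_le_one hC1 hr0.le hC
      have := Real.log_le_log (by linarith) this
      rw [Real.log_mul (by linarith) (Real.exp_pos _).ne', Real.log_exp] at this
      linarith
    have := Real.log_le_log hlM hle
    rw [Real.log_mul two_ne_zero (by positivity), Real.log_rpow hr0] at this
    rw [div_le_iff₀ (by linarith)] at e2
    rw [div_le_iff₀ hlog]
    nlinarith

lemma typeLE_of_limsup_le {g : ℂ → ℂ} (hg : Continuous g) {σ T : ℝ} (hT : 0 ≤ T)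
    (h : limsup (fun r : ℝ => ENNReal.ofReal (Real.log (maxModulus g r) / r ^ σ)) atTop
      ≤ ENNReal.ofReal T) : TypeLE g σ T := by
  intro B hB
  have hB0 := hT.trans_lt hB
  have h3 := eventually_lt_of_limsup_lt (h.trans_lt ((ENNReal.ofReal_lt_ofReal_iff hB0).2 hB))
  refine expBound_of_eventually hg hB0.le ?_
  filter_upwards [h3, eventually_gt_atTop 0] with r h3 hr
  exact le_exp_log_of_nonneg maxModulus_nonneg
    ((div_lt_iff₀ (by positivity)).1 ((ENNReal.ofReal_lt_ofReal_iff hB0).1 h3)).le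

lemma limsup_le_of_typeLE {g : ℂ → ℂ} {σ T : ℝ} (hσ : 0 < σ) (hT : 0 ≤ T)
    (h : TypeLE g σ T) :
    limsup (fun r : ℝ => ENNReal.ofReal (Real.log (maxModulus g r) / r ^ σ)) atTop
      ≤ ENNReal.ofReal T := by
  refine ENNReal_le_ofReal_of_forall_gt fun B hB => ?_
  refine limsup_le_of_le (by isBoundedDefault) ?_
  obtain ⟨B', h1, h2⟩ := exists_between hB
  have hB' : 0 < B' := hT.trans_lt h1
  obtain ⟨C, hC1, hC⟩ := (h B' h1).exists_one_le
  have e1 : ∀ᶠ r : ℝ in atTop, Real.log C / (B - B') ≤ r ^ σ :=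
    (tendsto_rpow_atTop hσ).eventually_ge_atTop _
  filter_upwards [e1, eventually_gt_atTop 0] with r e1 hr
  refine ENNReal.ofReal_le_ofReal ?_
  rw [div_le_iff₀ (by positivity)]
  rw [div_le_iff₀ (by linarith)] at e1
  have hle := maxModulus_le_of_bound hσ.le hB'.le hC1 hr.le hC
  rcases (maxModulus_nonneg (g := g) (r := r)).eq_or_lt with h0 | h0
  · rw [← h0, Real.log_zero]
    have := hB'.trans h2
    positivity
  · have := Real.log_le_log h0 hle
    rw [Real.log_mul (by linarith) (Real.exp_pos _).ne', Real.log_exp] at this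
    linarith

lemma entireOrder_le_iff {g : ℂ → ℂ} (hg : Differentiable ℂ g) {s : ℝ} (hs : 0 ≤ s) :
    entireOrder g ≤ ENNReal.ofReal s ↔ ∀ σ > s, TypeLE g σ 0 :=
  ⟨fun h _ hσ => typeLE_zero_of_entireOrder_le hg.continuous hs hσ h,
    entireOrder_le_of_typeLE hg hs⟩

lemma entireType_le_iff {g : ℂ → ℂ} (hg : Differentiable ℂ g) {σ T : ℝ} (hσ : 0 < σ) (hT : 0 ≤ T)
    (ho : entireOrder g = ENNReal.ofReal σ) :
    entireType g ≤ ENNReal.ofReal T ↔ TypeLE g σ T := by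
  rw [entireType, ho, ENNReal.toReal_ofReal hσ.le]
  exact ⟨typeLE_of_limsup_le hg.continuous hT, limsup_le_of_typeLE hσ hT⟩

/-! ### Coefficient sequences with weights `n^n` -/

/-- `‖c n‖ = O(μ ^ n * n ^ (α n))` for every `μ > l`. -/
def SeqLE (c : ℕ → ℂ) (α l : ℝ) : Prop :=
  ∀ μ > l, ∃ C : ℝ, ∀ n : ℕ, ‖c n‖ ≤ C * μ ^ n * ((n : ℝ) ^ n) ^ α

lemma self_pow_pos (n : ℕ) : 0 < (n : ℝ) ^ n := by
  rcases Nat.eq_zero_or_pos n with rfl | h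
  · simp
  · positivity

lemma self_pow_le_succ (n : ℕ) : (n : ℝ) ^ n ≤ ((n + 1 : ℕ) : ℝ) ^ (n + 1) := by
  calc (n : ℝ) ^ n ≤ ((n + 1 : ℕ) : ℝ) ^ n := by gcongr; simp
    _ ≤ _ := pow_le_pow_right₀ (by simp) (Nat.le_succ n)

lemma self_pow_succ_le (n : ℕ) :
    ((n + 1 : ℕ) : ℝ) ^ (n + 1) ≤ Real.exp 1 * (n + 1) * (n : ℝ) ^ n := by
  rcases Nat.eq_zero_or_pos n with rfl | h
  · simp
  · have hn : (0 : ℝ) < n := by exact_mod_cast h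
    have h1 : (n : ℝ) + 1 ≤ n * Real.exp (1 / n) := by
      have := Real.add_one_le_exp (1 / (n : ℝ))
      calc (n : ℝ) + 1 = n * (1 / n + 1) := by field_simp; ring
        _ ≤ _ := by gcongr
    have h2 : ((n : ℝ) + 1) ^ n ≤ (n : ℝ) ^ n * Real.exp 1 := by
      calc ((n : ℝ) + 1) ^ n ≤ (n * Real.exp (1 / n)) ^ n := by gcongr
        _ = _ := by rw [mul_pow, ← Real.exp_nat_mul]; congr 2; field_simp
    push_cast
    rw [pow_succ]
    nlinarith

lemma exp_one_mul_self_pow_le (n : ℕ) :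
    Real.exp 1 * (n * (n : ℝ) ^ n) ≤ ((n + 1 : ℕ) : ℝ) ^ (n + 1) := by
  have hn : (0 : ℝ) < n + 1 := by positivity
  have h1 : (n : ℝ) ≤ (n + 1) * Real.exp (-(1 / (n + 1))) := by
    have := Real.add_one_le_exp (-(1 / ((n : ℝ) + 1)))
    calc (n : ℝ) = (n + 1) * (-(1 / (n + 1)) + 1) := by field_simp; ring
      _ ≤ _ := by gcongr
  have h2 : (n : ℝ) ^ (n + 1) ≤ ((n : ℝ) + 1) ^ (n + 1) * Real.exp (-1) := by
    calc (n : ℝ) ^ (n + 1) ≤ ((n + 1) * Real.exp (-(1 / (n + 1)))) ^ (n + 1) := by gcongr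
      _ = _ := by
        rw [mul_pow, ← Real.exp_nat_mul]; congr 2; push_cast; field_simp
  rw [Real.exp_neg] at h2
  push_cast
  rw [← pow_succ', mul_comm]
  rwa [← div_eq_mul_inv, le_div_iff₀ (Real.exp_pos 1)] at h2

lemma factorial_le_self_pow (n : ℕ) :
    (n.factorial : ℝ) ≤ Real.exp 1 * (n + 1) * ((n : ℝ) ^ n * Real.exp (-n)) := by
  -- The induction uses the sharper factor `e n`, which is only valid from `n = 1` on.
  have key : ∀ n : ℕ, ((n + 1).factorial : ℝ) ≤
      Real.exp 1 * (n + 1) * (((n + 1 : ℕ) : ℝ) ^ (n + 1) * Real.exp (-(n + 1 : ℕ))) := by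
    intro n
    induction n with
    | zero => simp [← Real.exp_add]
    | succ n ih =>
      have h1 := exp_one_mul_self_pow_le (n + 1)
      have e : Real.exp (-((n + 1 : ℕ) : ℝ)) = Real.exp 1 * Real.exp (-((n + 1 + 1 : ℕ) : ℝ)) := by
        rw [← Real.exp_add]; congr 1; push_cast; ring
      rw [Nat.factorial_succ, Nat.cast_mul]
      calc ((n + 1 + 1 : ℕ) : ℝ) * ((n + 1).factorial : ℝ)
          ≤ ((n + 1 + 1 : ℕ) : ℝ) *
            (Real.exp 1 * (n + 1) * (((n + 1 : ℕ) : ℝ) ^ (n + 1) * Real.exp (-(n + 1 : ℕ)))) := by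
            gcongr
        _ = ((n + 1 + 1 : ℕ) : ℝ) * Real.exp 1 * Real.exp (-((n + 1 + 1 : ℕ) : ℝ)) *
            (Real.exp 1 * (((n + 1 : ℕ) : ℝ) * ((n + 1 : ℕ) : ℝ) ^ (n + 1))) := by
            rw [e]; push_cast; ring
        _ ≤ ((n + 1 + 1 : ℕ) : ℝ) * Real.exp 1 * Real.exp (-((n + 1 + 1 : ℕ) : ℝ)) *
            ((n + 1 + 1 : ℕ) : ℝ) ^ (n + 1 + 1) := by gcongr
        _ = _ := by push_cast; ring
  rcases n with _ | n
  · simp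
  · refine (key n).trans ?_
    gcongr
    linarith

lemma self_pow_mul_exp_le_factorial (n : ℕ) :
    (n : ℝ) ^ n * Real.exp (-n) ≤ n.factorial := by
  have := Real.pow_div_factorial_le_exp (x := n) (by positivity) n
  rw [div_le_iff₀ (by positivity)] at this
  rw [Real.exp_neg, ← div_eq_mul_inv, div_le_iff₀ (Real.exp_pos _), mul_comm]
  exact this

/-- Powers are dominated by exponentials. -/
lemma exists_rpow_le_mul_pow {q : ℝ} (hq : 1 < q) {a : ℝ} (ha : 0 ≤ a) :
    ∃ K : ℝ, 1 ≤ K ∧ ∀ n : ℕ, (Real.exp 1 * (n + 1)) ^ a ≤ K * q ^ n := by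
  have ha1 : 0 < a + 1 := by linarith
  set d := Real.log q / (a + 1) with hd
  have hd0 : 0 < d := div_pos (Real.log_pos hq) ha1
  refine ⟨max 1 ((Real.exp 1 / d) ^ (a + 1) * q), le_max_left _ _, fun n => ?_⟩
  have hq0 : 0 < q := by linarith
  have h1 : (1 : ℝ) ≤ Real.exp 1 * (n + 1) := by
    have := Real.add_one_le_exp (1 : ℝ)
    have : (0 : ℝ) ≤ n := by positivity
    nlinarith
  calc (Real.exp 1 * (n + 1)) ^ a ≤ (Real.exp 1 * (n + 1)) ^ (a + 1) :=
        Real.rpow_le_rpow_of_exponent_le h1 (by linarith)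
    _ = (Real.exp 1 / d) ^ (a + 1) * (d * (n + 1)) ^ (a + 1) := by
        rw [← Real.mul_rpow (by positivity) (by positivity)]; congr 1; field_simp
    _ ≤ (Real.exp 1 / d) ^ (a + 1) * (Real.exp (d * (n + 1))) ^ (a + 1) := by
        gcongr
        linarith [Real.add_one_le_exp (d * ((n : ℝ) + 1))]
    _ = (Real.exp 1 / d) ^ (a + 1) * q * q ^ n := by
        rw [← Real.exp_mul, mul_assoc _ q, ← pow_succ', mul_assoc d]
        congr 1
        rw [← Real.rpow_natCast, Real.rpow_def_of_pos hq0, hd]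
        congr 1; push_cast; field_simp
    _ ≤ _ := by gcongr; exact le_max_right _ _

lemma rpow_comparable {X Y P : ℝ} (hX : 0 < X) (hXY : X ≤ Y) (hP : 1 ≤ P) (hYP : Y ≤ P * X)
    (α : ℝ) : Y ^ α ≤ P ^ |α| * X ^ α ∧ X ^ α ≤ P ^ |α| * Y ^ α := by
  have hP0 : 0 < P := by linarith
  have hY : 0 < Y := by linarith
  have h1 : 1 ≤ P ^ |α| := Real.one_le_rpow hP (abs_nonneg _)
  rcases le_total 0 α with h | h
  · have hm := Real.rpow_le_rpow hX.le hXY h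
    refine ⟨?_, hm.trans (le_mul_of_one_le_left (by positivity) h1)⟩
    rw [abs_of_nonneg h, ← Real.mul_rpow hP0.le hX.le]
    exact Real.rpow_le_rpow hY.le hYP h
  · have hm := Real.rpow_le_rpow_of_nonpos hX hXY h
    refine ⟨hm.trans (le_mul_of_one_le_left (by positivity) h1), ?_⟩
    have := Real.rpow_le_rpow_of_nonpos hY hYP h
    rw [Real.mul_rpow hP0.le hX.le] at this
    rw [abs_of_nonpos h, Real.rpow_neg hP0.le]
    rwa [inv_mul_eq_div, le_div_iff₀' (by positivity)]

/-- Consecutive weights `n^n` differ by a factor between `1` and `e(n+1)`, whose powers are absorbed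
by `q^n`. An index shift thus costs nothing in `SeqLE`. -/
lemma exists_weight_comparable {q : ℝ} (hq : 1 < q) (α : ℝ) :
    ∃ K : ℝ, 1 ≤ K ∧ ∀ n : ℕ,
      (((n + 1 : ℕ) : ℝ) ^ (n + 1)) ^ α ≤ K * q ^ n * ((n : ℝ) ^ n) ^ α ∧
      ((n : ℝ) ^ n) ^ α ≤ K * q ^ n * (((n + 1 : ℕ) : ℝ) ^ (n + 1)) ^ α := by
  obtain ⟨K, hK1, hK⟩ := exists_rpow_le_mul_pow hq (abs_nonneg α)
  refine ⟨K, hK1, fun n => ?_⟩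
  have h1 : (1 : ℝ) ≤ Real.exp 1 * (n + 1) := by
    have := Real.add_one_le_exp (1 : ℝ)
    have : (0 : ℝ) ≤ n := by positivity
    nlinarith
  obtain ⟨h2, h3⟩ := rpow_comparable (self_pow_pos n) (self_pow_le_succ n) h1
    (self_pow_succ_le n) α
  have := self_pow_pos n
  have := self_pow_pos (n + 1)
  exact ⟨h2.trans (by gcongr; exact hK n), h3.trans (by gcongr; exact hK n)⟩

/-- Source of the doubled exponent and of the factor `4^α` in the rate when only every second
coefficient is kept. -/
lemma self_pow_two_mul_rpow (k : ℕ) (α : ℝ) :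
    (((2 * k : ℕ) : ℝ) ^ (2 * k)) ^ α = ((4 : ℝ) ^ α) ^ k * ((k : ℝ) ^ k) ^ (2 * α) := by
  have h := self_pow_pos k
  have e : ((2 * k : ℕ) : ℝ) ^ (2 * k) = 4 ^ k * ((k : ℝ) ^ k) ^ 2 := by
    push_cast
    rw [mul_pow, pow_mul 2 2 k, mul_comm 2 k, pow_mul (k : ℝ) k 2]; norm_num
  rw [e, Real.mul_rpow (by positivity) (by positivity), ← Real.rpow_natCast, ← Real.rpow_mul
    (by positivity), ← Real.rpow_natCast (4 ^ α), ← Real.rpow_mul (by positivity), mul_comm (k : ℝ),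
    ← Real.rpow_natCast _ 2, ← Real.rpow_mul h.le]
  norm_num

lemma SeqLE.exists_one_le {c : ℕ → ℂ} {α l μ : ℝ} (hl : 0 ≤ l) (h : SeqLE c α l) (hμ : l < μ) :
    ∃ C : ℝ, 1 ≤ C ∧ ∀ n : ℕ, ‖c n‖ ≤ C * μ ^ n * ((n : ℝ) ^ n) ^ α := by
  obtain ⟨C, hC⟩ := h μ hμ
  have hμ0 : 0 < μ := hl.trans_lt hμ
  refine ⟨max C 1, le_max_right _ _, fun n => (hC n).trans ?_⟩
  have := self_pow_pos n
  gcongr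
  exact le_max_left _ _

lemma SeqLE.shift {c : ℕ → ℂ} {α l : ℝ} (hl : 0 ≤ l) (h : SeqLE c α l) :
    SeqLE (fun n => c (n + 1)) α l := by
  intro μ hμ
  obtain ⟨μ', h1, h2⟩ := exists_between hμ
  have hμ' : 0 < μ' := hl.trans_lt h1
  obtain ⟨C, hC1, hC⟩ := h.exists_one_le hl h1
  obtain ⟨K, hK1, hK⟩ := exists_weight_comparable ((one_lt_div hμ').2 h2) α
  refine ⟨C * μ' * K, fun n => (hC (n + 1)).trans ?_⟩
  calc C * μ' ^ (n + 1) * (((n + 1 : ℕ) : ℝ) ^ (n + 1)) ^ α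
      ≤ C * μ' ^ (n + 1) * (K * (μ / μ') ^ n * ((n : ℝ) ^ n) ^ α) := by
        gcongr; exact (hK n).1
    _ = C * μ' * K * μ ^ n * ((n : ℝ) ^ n) ^ α := by
        rw [div_pow, pow_succ]; field_simp

lemma SeqLE.of_shift {c : ℕ → ℂ} {α l : ℝ} (hl : 0 ≤ l) (h : SeqLE (fun n => c (n + 1)) α l) :
    SeqLE c α l := by
  intro μ hμ
  obtain ⟨μ', h1, h2⟩ := exists_between hμ
  have hμ' : 0 < μ' := hl.trans_lt h1
  have hμ0 : 0 < μ := hμ'.trans h2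
  obtain ⟨C, hC1, hC⟩ := h.exists_one_le hl h1
  obtain ⟨K, hK1, hK⟩ := exists_weight_comparable ((one_lt_div hμ').2 h2) α
  refine ⟨max ‖c 0‖ (C * K / μ), fun n => ?_⟩
  rcases n with _ | n
  · simp
  · calc ‖c (n + 1)‖ ≤ C * μ' ^ n * ((n : ℝ) ^ n) ^ α := hC n
      _ ≤ C * μ' ^ n * (K * (μ / μ') ^ n * (((n + 1 : ℕ) : ℝ) ^ (n + 1)) ^ α) := by
          gcongr; exact (hK n).2
      _ = C * K / μ * μ ^ (n + 1) * (((n + 1 : ℕ) : ℝ) ^ (n + 1)) ^ α := by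
          rw [div_pow, pow_succ μ]; field_simp
      _ ≤ _ := by
          have := self_pow_pos (n + 1)
          gcongr; exact le_max_right _ _

lemma SeqLE.even {c : ℕ → ℂ} {α l : ℝ} (hl : 0 ≤ l) (h : SeqLE c α l) :
    SeqLE (fun k => c (2 * k)) (2 * α) (l ^ 2 * 4 ^ α) := by
  intro ν hν
  have h4 : (0 : ℝ) < 4 ^ α := by positivity
  have h1 : l < √(ν / 4 ^ α) := by
    rw [Real.lt_sqrt hl, lt_div_iff₀ h4]; exact hν
  obtain ⟨C, hC⟩ := h _ h1
  have hν0 : 0 ≤ ν := (by positivity : 0 ≤ l ^ 2 * 4 ^ α).trans hν.le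
  refine ⟨C, fun k => (hC (2 * k)).trans_eq ?_⟩
  rw [self_pow_two_mul_rpow, pow_mul, Real.sq_sqrt (by positivity), div_pow]
  field_simp

lemma SeqLE.odd {c : ℕ → ℂ} {α l : ℝ} (hl : 0 ≤ l) (h : SeqLE c α l) :
    SeqLE (fun k => c (2 * k + 1)) (2 * α) (l ^ 2 * 4 ^ α) := (h.shift hl).even hl

lemma SeqLE.of_even_odd {c : ℕ → ℂ} {α l : ℝ} (hl : 0 ≤ l)
    (he : SeqLE (fun k => c (2 * k)) (2 * α) (l ^ 2 * 4 ^ α))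
    (ho : SeqLE (fun k => c (2 * k + 1)) (2 * α) (l ^ 2 * 4 ^ α)) : SeqLE c α l := by
  intro μ hμ
  obtain ⟨μ', h1, h2⟩ := exists_between hμ
  have hμ' : 0 < μ' := hl.trans_lt h1
  have hμ0 : 0 < μ := hμ'.trans h2
  have h4 : (0 : ℝ) < 4 ^ α := by positivity
  have hν : l ^ 2 * 4 ^ α < μ' ^ 2 * 4 ^ α := by gcongr
  have hl' : 0 ≤ l ^ 2 * 4 ^ α := by positivity
  obtain ⟨C, hC1, hC⟩ := he.exists_one_le hl' hν
  obtain ⟨D, hD1, hD⟩ := ho.exists_one_le hl' hν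
  obtain ⟨K, hK1, hK⟩ := exists_weight_comparable ((one_lt_div hμ').2 h2) α
  have key : ∀ k : ℕ, (μ' ^ 2 * 4 ^ α) ^ k * ((k : ℝ) ^ k) ^ (2 * α) =
      μ' ^ (2 * k) * (((2 * k : ℕ) : ℝ) ^ (2 * k)) ^ α := fun k => by
    rw [self_pow_two_mul_rpow, mul_pow, ← pow_mul]; ring
  refine ⟨max C (D * K / μ), fun n => ?_⟩
  have hw := self_pow_pos n
  obtain ⟨k, rfl | rfl⟩ := Nat.even_or_odd' n
  · calc ‖c (2 * k)‖ ≤ C * (μ' ^ 2 * 4 ^ α) ^ k * ((k : ℝ) ^ k) ^ (2 * α) := hC k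
      _ = C * μ' ^ (2 * k) * (((2 * k : ℕ) : ℝ) ^ (2 * k)) ^ α := by rw [mul_assoc, key, mul_assoc]
      _ ≤ _ := by gcongr; exact le_max_left _ _
  · calc ‖c (2 * k + 1)‖ ≤ D * (μ' ^ 2 * 4 ^ α) ^ k * ((k : ℝ) ^ k) ^ (2 * α) := hD k
      _ = D * μ' ^ (2 * k) * (((2 * k : ℕ) : ℝ) ^ (2 * k)) ^ α := by rw [mul_assoc, key, mul_assoc]
      _ ≤ D * μ' ^ (2 * k) * (K * (μ / μ') ^ (2 * k) *
          (((2 * k + 1 : ℕ) : ℝ) ^ (2 * k + 1)) ^ α) := by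
        gcongr; exact (hK (2 * k)).2
      _ = D * K / μ * μ ^ (2 * k + 1) * (((2 * k + 1 : ℕ) : ℝ) ^ (2 * k + 1)) ^ α := by
        rw [div_pow, pow_succ μ]; field_simp
      _ ≤ _ := by gcongr; exact le_max_right _ _

/-! ### Growth of an entire function and of its derivatives at a point -/

/-- The geometric rate of the derivatives `g⁽ⁿ⁾` of a function of order `σ` and type `T`. -/
def derivRate (σ T : ℝ) : ℝ := (Real.exp 1 * T * σ) ^ (1 / σ) / Real.exp 1

lemma derivRate_nonneg {σ T : ℝ} (hσ : 0 ≤ σ) (hT : 0 ≤ T) : 0 ≤ derivRate σ T := by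
  unfold derivRate; positivity

lemma derivRate_pos {σ T : ℝ} (hσ : 0 < σ) (hT : 0 < T) : 0 < derivRate σ T := by
  unfold derivRate; positivity

lemma derivRate_zero {σ : ℝ} (hσ : 0 < σ) : derivRate σ 0 = 0 := by
  simp [derivRate, Real.zero_rpow (inv_ne_zero hσ.ne')]

lemma derivRate_lt {σ T B : ℝ} (hσ : 0 < σ) (hT : 0 ≤ T) (h : T < B) :
    derivRate σ T < derivRate σ B := by
  unfold derivRate
  gcongr

lemma continuous_derivRate {σ : ℝ} (hσ : 0 < σ) : Continuous (derivRate σ) := by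
  unfold derivRate
  refine Continuous.div_const ?_ _
  exact (by fun_prop : Continuous fun T : ℝ => Real.exp 1 * T * σ).rpow_const
    fun _ => Or.inr (by positivity)

/-- Cauchy's estimate at the optimal radius, combined with Stirling. `B` and `K` are chosen before
`g`, `C` and `u`, so the bound is uniform in the centre. -/
lemma norm_iteratedDeriv_le_of_growth {σ T μ : ℝ} (hσ : 0 < σ) (hT : 0 ≤ T)
    (hμ : derivRate σ T < μ) :
    ∃ B > T, ∃ K : ℝ, 1 ≤ K ∧ ∀ (g : ℂ → ℂ) (C : ℝ) (u : ℂ), Differentiable ℂ g →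
      (∀ z, ‖g z‖ ≤ C * Real.exp (B * ‖z - u‖ ^ σ)) →
      ∀ n : ℕ, ‖iteratedDeriv n g u‖ ≤ C * K * μ ^ n * ((n : ℝ) ^ n) ^ (1 - 1 / σ) := by
  obtain ⟨B, hBμ, hB⟩ : ∃ B, derivRate σ B < μ ∧ T < B := by
    have h1 := ((continuous_derivRate hσ).tendsto T).eventually_lt_const hμ
    exact ((h1.filter_mono nhdsWithin_le_nhds).and
      (self_mem_nhdsWithin : Set.Ioi T ∈ 𝓝[>] T)).exists
  have hB0 : 0 < B := hT.trans_lt hB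
  have hL := derivRate_pos hσ hB0
  obtain ⟨K, hK1, hK⟩ := exists_rpow_le_mul_pow ((one_lt_div hL).2 hBμ) zero_le_one
  refine ⟨B, hB, K, hK1, fun g C u hg hC n => ?_⟩
  have hC0 : 0 ≤ C := by
    have := (norm_nonneg _).trans (hC u)
    exact nonneg_of_mul_nonneg_left this (Real.exp_pos _)
  rcases Nat.eq_zero_or_pos n with rfl | hn
  · have := hC u
    simp only [sub_self, norm_zero, Real.zero_rpow hσ.ne', mul_zero, Real.exp_zero, mul_one] at this
    simpa using this.trans (le_mul_of_one_le_right hC0 hK1)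
  have hn0 : (0 : ℝ) < n := by exact_mod_cast hn
  -- This radius minimises `exp(B r^σ) / r^n`: there `B σ r^σ = n`.
  set r : ℝ := (n / (B * σ)) ^ (1 / σ) with hr
  have hr0 : 0 < r := by positivity
  have hrσ : B * r ^ σ = n / σ := by
    rw [hr, ← Real.rpow_mul (by positivity), one_div_mul_cancel hσ.ne', Real.rpow_one]; field_simp
  have h1 := Complex.norm_iteratedDeriv_le_of_forall_mem_sphere_norm_le (c := u) n hr0 hg.diffContOnCl
    (C := C * Real.exp (n / σ)) (fun z hz => by
      rw [← hrσ, ← mem_sphere_iff_norm.1 hz]; exact hC z)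
  have hw := self_pow_pos n
  have hexp : Real.exp (n / σ) / r ^ n =
      (derivRate σ B * Real.exp 1) ^ n * ((n : ℝ) ^ n) ^ (-(1 / σ)) := by
    have e1 : r ^ n = ((n : ℝ) ^ n) ^ (1 / σ) / ((B * σ) ^ (1 / σ)) ^ n := by
      rw [hr, Real.div_rpow hn0.le (by positivity), div_pow]
      congr 1
      rw [← Real.rpow_natCast, ← Real.rpow_mul hn0.le, mul_comm, Real.rpow_mul hn0.le,
        Real.rpow_natCast]
    have e2 : Real.exp (n / σ) = (Real.exp 1 ^ (1 / σ)) ^ n := by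
      rw [← Real.exp_mul, ← Real.exp_nat_mul]; congr 1; field_simp
    rw [e1, e2, derivRate, div_mul_cancel₀ _ (Real.exp_pos 1).ne', Real.rpow_neg hw.le, mul_assoc,
      Real.mul_rpow (x := Real.exp 1) (by positivity) (by positivity), mul_pow]
    field_simp
  calc ‖iteratedDeriv n g u‖ ≤ n.factorial * (C * Real.exp (n / σ)) / r ^ n := h1
    _ = C * n.factorial * (Real.exp (n / σ) / r ^ n) := by ring
    _ ≤ C * (Real.exp 1 * (n + 1) * ((n : ℝ) ^ n * Real.exp (-n))) *
        ((derivRate σ B * Real.exp 1) ^ n * ((n : ℝ) ^ n) ^ (-(1 / σ))) := by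
        rw [hexp]; gcongr; exact factorial_le_self_pow n
    _ = C * (Real.exp 1 * (n + 1)) ^ (1 : ℝ) * derivRate σ B ^ n *
        ((n : ℝ) ^ n) ^ (1 - 1 / σ) := by
        rw [Real.rpow_one, sub_eq_add_neg, Real.rpow_add hw, Real.rpow_one, mul_pow,
          Real.exp_neg, ← Real.exp_nat_mul, mul_one]
        field_simp
    _ ≤ C * (K * (μ / derivRate σ B) ^ n) * derivRate σ B ^ n *
        ((n : ℝ) ^ n) ^ (1 - 1 / σ) := by
        gcongr; exact hK n
    _ = _ := by rw [div_pow]; field_simp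

/-- Since `(x+R)^σ ~ x^σ`, moving the centre of a growth bound costs an arbitrarily small increase
of the type. -/
lemma exists_add_rpow_le {σ R T B : ℝ} (hσ : 0 < σ) (hR : 0 ≤ R) (hT : 0 ≤ T) (hB : T < B) :
    ∃ K : ℝ, ∀ x ≥ 0, T * (x + R) ^ σ ≤ B * x ^ σ + K := by
  obtain ⟨δ, hδ, hδ0⟩ : ∃ δ, T * (1 + δ) ^ σ < B ∧ 0 < δ := by
    have hc : Continuous fun δ : ℝ => T * (1 + δ) ^ σ :=
      continuous_const.mul ((continuous_const.add continuous_id).rpow_const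
        fun _ => Or.inr hσ.le)
    have h1 := (hc.tendsto 0).eventually_lt_const (u := B) (by simpa using hB)
    exact ((h1.filter_mono nhdsWithin_le_nhds).and
      (self_mem_nhdsWithin : Set.Ioi (0 : ℝ) ∈ 𝓝[>] 0)).exists
  have hB0 : 0 < B := hT.trans_lt hB
  refine ⟨T * (R / δ + R) ^ σ, fun x hx => ?_⟩
  rcases le_total (R / δ) x with h | h
  · have h2 : x + R ≤ (1 + δ) * x := by
      rw [div_le_iff₀ hδ0] at h; linarith
    calc T * (x + R) ^ σ ≤ T * ((1 + δ) * x) ^ σ := by gcongr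
      _ = T * (1 + δ) ^ σ * x ^ σ := by rw [Real.mul_rpow (by positivity) hx, mul_assoc]
      _ ≤ B * x ^ σ := by gcongr
      _ ≤ _ := le_add_of_nonneg_right (by positivity)
  · calc T * (x + R) ^ σ ≤ T * (R / δ + R) ^ σ := by gcongr
      _ ≤ _ := le_add_of_nonneg_left (by positivity)

lemma TypeLE.exists_translate {g : ℂ → ℂ} {σ T B R : ℝ} (hσ : 0 < σ) (hT : 0 ≤ T) (hR : 0 ≤ R)
    (h : TypeLE g σ T) (hB : T < B) :
    ∃ C : ℝ, 1 ≤ C ∧ ∀ u z : ℂ, ‖u‖ ≤ R → ‖g z‖ ≤ C * Real.exp (B * ‖z - u‖ ^ σ) := by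
  obtain ⟨B', h1, h2⟩ := exists_between hB
  have hB' : 0 < B' := hT.trans_lt h1
  obtain ⟨C, hC1, hC⟩ := (h B' h1).exists_one_le
  obtain ⟨K, hK⟩ := exists_add_rpow_le hσ hR hB'.le h2
  refine ⟨C * Real.exp |K|, one_le_mul_of_one_le_of_one_le hC1 (Real.one_le_exp (abs_nonneg K)),
    fun u z hu => (hC z).trans ?_⟩
  rw [mul_assoc, ← Real.exp_add]
  have hz : ‖z‖ ≤ ‖z - u‖ + R := by
    have := norm_sub_norm_le z u
    linarith
  have : B' * ‖z‖ ^ σ ≤ B' * (‖z - u‖ + R) ^ σ := by gcongr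
  have := hK ‖z - u‖ (norm_nonneg _)
  have := le_abs_self K
  gcongr
  linarith

lemma TypeLE.exists_norm_iteratedDeriv_le {g : ℂ → ℂ} {σ T μ R : ℝ} (hg : Differentiable ℂ g)
    (hσ : 0 < σ) (hT : 0 ≤ T) (hR : 0 ≤ R) (h : TypeLE g σ T) (hμ : derivRate σ T < μ) :
    ∃ C : ℝ, 1 ≤ C ∧ ∀ u : ℂ, ‖u‖ ≤ R → ∀ n : ℕ,
      ‖iteratedDeriv n g u‖ ≤ C * μ ^ n * ((n : ℝ) ^ n) ^ (1 - 1 / σ) := by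
  obtain ⟨B, hB, K, hK1, hK⟩ := norm_iteratedDeriv_le_of_growth hσ hT hμ
  obtain ⟨C, hC1, hC⟩ := h.exists_translate hσ hT hR hB
  exact ⟨C * K, one_le_mul_of_one_le_of_one_le hC1 hK1, fun u hu =>
    hK g C u hg fun z => hC u z hu⟩

lemma TypeLE.seqLE {g : ℂ → ℂ} {σ T : ℝ} (hg : Differentiable ℂ g) (hσ : 0 < σ) (hT : 0 ≤ T)
    (h : TypeLE g σ T) (u : ℂ) :
    SeqLE (fun n => iteratedDeriv n g u) (1 - 1 / σ) (derivRate σ T) := by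
  intro μ hμ
  obtain ⟨C, -, hC⟩ := h.exists_norm_iteratedDeriv_le hg hσ hT (norm_nonneg u) hμ
  exact ⟨C, hC u le_rfl⟩

lemma typeLE_of_seqLE {g : ℂ → ℂ} {σ T : ℝ} (hg : Differentiable ℂ g) (hσ : 0 < σ) (hT : 0 ≤ T)
    (u : ℂ) (h : SeqLE (fun n => iteratedDeriv n g u) (1 - 1 / σ) (derivRate σ T)) :
    TypeLE g σ T := by
  have key : TypeLE (fun z => g (z + u)) σ T := by
    intro B hB
    obtain ⟨B', h1, h2⟩ := exists_between hB
    have hB' : 0 < B' := hT.trans_lt h1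
    have hB0 : 0 < B := hB'.trans h2
    obtain ⟨C, hC1, hC⟩ := h.exists_one_le (derivRate_nonneg hσ.le hT) (derivRate_lt hσ hT h1)
    -- Each Taylor term will be at most `C exp(B r^σ) q^n`; the gap `B' < B` is spent on making the
    -- series geometric.
    set q : ℝ := (B' / B) ^ (1 / σ) with hq
    have hq0 : 0 ≤ q := by positivity
    have hq1 : q < 1 := Real.rpow_lt_one (by positivity) ((div_lt_one hB0).2 h2) (by positivity)
    refine ⟨C * (1 - q)⁻¹, fun z => ?_⟩
    have hsum := Complex.hasSum_taylorSeries_of_entire hg u (z + u)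
    have hgeo : HasSum (fun n : ℕ => C * Real.exp (B * ‖z‖ ^ σ) * q ^ n)
        (C * Real.exp (B * ‖z‖ ^ σ) * (1 - q)⁻¹) :=
      (hasSum_geometric_of_lt_one hq0 hq1).mul_left _
    have hle : ∀ n : ℕ, ‖(n.factorial : ℂ)⁻¹ • (z + u - u) ^ n • iteratedDeriv n g u‖ ≤
        C * Real.exp (B * ‖z‖ ^ σ) * q ^ n := by
      intro n
      have hw := self_pow_pos n
      set r := ‖z‖ with hr
      have hr0 : 0 ≤ r := norm_nonneg z
      rw [add_sub_cancel_right, norm_smul, norm_smul, norm_inv, norm_pow, Complex.norm_natCast,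
        ← hr]
      have hfac : (n.factorial : ℝ)⁻¹ ≤ Real.exp n * ((n : ℝ) ^ n)⁻¹ := by
        have := inv_anti₀ (by positivity) (self_pow_mul_exp_le_factorial n)
        rwa [mul_inv, Real.exp_neg, inv_inv, mul_comm] at this
      have hA : (derivRate σ B' * Real.exp 1 * r) ^ n * ((n : ℝ) ^ n) ^ (-(1 / σ)) ≤
          Real.exp (B * r ^ σ) * q ^ n := by
        set y := B * σ * r ^ σ with hy
        have hy0 : 0 ≤ y := by positivity
        -- The `n`-th power of `e x ≤ exp x` at `x = y / n`.
        have hpow : (Real.exp 1 * y) ^ n ≤ Real.exp y * (n : ℝ) ^ n := by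
          have := self_pow_pos n
          rcases Nat.eq_zero_or_pos n with rfl | hn
          · simpa using Real.one_le_exp hy0
          have hn0 : (0 : ℝ) < n := by exact_mod_cast hn
          have h4 : Real.exp 1 * y ≤ n * Real.exp (y / n) := by
            have := Real.add_one_le_exp (y / n - 1)
            rw [sub_add_cancel, Real.exp_sub, le_div_iff₀ (Real.exp_pos 1)] at this
            calc Real.exp 1 * y = n * (y / n * Real.exp 1) := by field_simp
              _ ≤ _ := by gcongr
          calc (Real.exp 1 * y) ^ n ≤ (n * Real.exp (y / n)) ^ n := by gcongr
            _ = _ := by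
              rw [mul_pow, ← Real.exp_nat_mul, mul_comm]; congr 2; field_simp
        have h5 := Real.rpow_le_rpow (by positivity) hpow (by positivity : 0 ≤ 1 / σ)
        rw [Real.mul_rpow (by positivity) (by positivity), ← Real.exp_mul] at h5
        have e1 : y * (1 / σ) = B * r ^ σ := by rw [hy]; field_simp
        have e2 : (derivRate σ B' * Real.exp 1 * r) ^ n = ((Real.exp 1 * y) ^ n) ^ (1 / σ) * q ^ n := by
          have : derivRate σ B' * Real.exp 1 * r = (Real.exp 1 * y) ^ (1 / σ) * q := by
            rw [derivRate, div_mul_cancel₀ _ (Real.exp_pos 1).ne', hq,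
              ← Real.mul_rpow (by positivity) (by positivity),
              show Real.exp 1 * y * (B' / B) = Real.exp 1 * B' * σ * r ^ σ by
                rw [hy]; field_simp,
              Real.mul_rpow (y := r ^ σ) (by positivity) (by positivity), ← Real.rpow_mul hr0,
              mul_one_div_cancel hσ.ne', Real.rpow_one]
          rw [this, mul_pow]
          congr 1
          rw [← Real.rpow_natCast, ← Real.rpow_natCast, ← Real.rpow_mul (by positivity),
            ← Real.rpow_mul (by positivity), mul_comm (1 / σ)]
        rw [e2, Real.rpow_neg hw.le, ← div_eq_mul_inv, div_le_iff₀ (by positivity)]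
        rw [e1] at h5
        calc _ ≤ Real.exp (B * r ^ σ) * ((n : ℝ) ^ n) ^ (1 / σ) * q ^ n := by gcongr
          _ = _ := by ring
      calc (n.factorial : ℝ)⁻¹ * (r ^ n * ‖iteratedDeriv n g u‖)
          ≤ Real.exp n * ((n : ℝ) ^ n)⁻¹ *
            (r ^ n * (C * derivRate σ B' ^ n * ((n : ℝ) ^ n) ^ (1 - 1 / σ))) := by
            gcongr; exact hC n
        _ = C * ((derivRate σ B' * Real.exp 1 * r) ^ n * ((n : ℝ) ^ n) ^ (-(1 / σ))) := by
            rw [sub_eq_add_neg, Real.rpow_add hw, Real.rpow_one, mul_pow, mul_pow,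
              ← Real.exp_nat_mul, mul_one]
            field_simp
        _ ≤ C * (Real.exp (B * r ^ σ) * q ^ n) := by gcongr
        _ = _ := by ring
    have := hsum.norm_le_of_bounded hgeo hle
    calc _ ≤ _ := this
      _ = _ := by ring
  intro B hB
  obtain ⟨C, -, hC⟩ := key.exists_translate hσ hT (norm_nonneg u) hB
  refine ⟨C, fun z => ?_⟩
  simpa using hC (-u) (z - u) (by simp)

lemma typeLE_iff_seqLE {g : ℂ → ℂ} {σ T : ℝ} (hg : Differentiable ℂ g) (hσ : 0 < σ) (hT : 0 ≤ T)
    (u : ℂ) :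
    TypeLE g σ T ↔ SeqLE (fun n => iteratedDeriv n g u) (1 - 1 / σ) (derivRate σ T) :=
  ⟨fun h => h.seqLE hg hσ hT u, typeLE_of_seqLE hg hσ hT u⟩

/-! ### Local boundedness of caloric functions and the derivative identity -/

/-- Local boundedness of a function of two variables on `V × U`. -/
def LocallyBounded (H : ℂ → ℂ → ℂ) (V U : Set ℂ) : Prop :=
  ∀ t ∈ V, ∀ z ∈ U, ∃ ε > 0, ∃ C : ℝ, ∀ s ∈ ball t ε, ∀ w ∈ ball z ε, ‖H s w‖ ≤ C

lemma LocallyBounded.deriv {H : ℂ → ℂ → ℂ} {V U : Set ℂ} (hb : LocallyBounded H V U)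
    (hH : ∀ t, Differentiable ℂ (H t)) : LocallyBounded (fun t => deriv (H t)) V U := by
  intro t ht z hz
  obtain ⟨ε, hε, C, hC⟩ := hb t ht z hz
  refine ⟨ε / 2, by positivity, C / (ε / 2), fun s hs w hw => ?_⟩
  refine Complex.norm_deriv_le_of_forall_mem_sphere_norm_le (by positivity) (hH s).diffContOnCl ?_
  intro v hv
  refine hC s (ball_subset_ball (by linarith) hs) v ?_
  rw [mem_ball] at hw ⊢
  rw [mem_sphere] at hv
  linarith [dist_triangle v w z]

/-- Interchange of `∂_t` and `∂_z` for locally bounded, separately holomorphic functions. -/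
lemma hasDerivAt_deriv_of_locallyBounded {H H' : ℂ → ℂ → ℂ} {V U : Set ℂ} (hV : IsOpen V)
    (hU : IsOpen U) (hb : LocallyBounded H V U) (hH : ∀ t, Differentiable ℂ (H t))
    (hH' : ∀ t, Differentiable ℂ (H' t))
    (hd : ∀ t ∈ V, ∀ z ∈ U, HasDerivAt (fun s => H s z) (H' t z) t)
    {t z : ℂ} (ht : t ∈ V) (hz : z ∈ U) :
    HasDerivAt (fun s => deriv (H s) z) (deriv (H' t) z) t := by
  obtain ⟨ε₁, hε₁, C, hC⟩ := hb t ht z hz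
  obtain ⟨ε₂, hε₂, hV'⟩ := Metric.isOpen_iff.1 hV t ht
  obtain ⟨ε₃, hε₃, hU'⟩ := Metric.isOpen_iff.1 hU z hz
  set ε := min ε₁ (min ε₂ ε₃) with hε_def
  have hε : 0 < ε := by positivity
  have h1 : ε ≤ ε₁ := min_le_left _ _
  have h2 : ε ≤ ε₂ := (min_le_right _ _).trans (min_le_left _ _)
  have h3 : ε ≤ ε₃ := (min_le_right _ _).trans (min_le_right _ _)
  set r := ε / 2 with hr_def
  have hr : 0 < r := by positivity
  have hcirc : ∀ θ : ℝ, circleMap z r θ ∈ ball z ε := fun θ => by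
    have := circleMap_mem_sphere z hr.le θ
    rw [mem_sphere] at this
    rw [mem_ball, this]; linarith
  -- The `z`-derivative becomes a circle integral, which is then differentiated in `t` under the
  -- integral sign.
  have cauchy : ∀ g : ℂ → ℂ, Differentiable ℂ g → deriv g z =
      (2 * Real.pi * Complex.I : ℂ)⁻¹ • ∫ θ in (0 : ℝ)..2 * Real.pi,
        deriv (circleMap z r) θ • (((circleMap z r θ - z) ^ 2)⁻¹ • g (circleMap z r θ)) :=
    fun g hg => (Complex.two_pi_I_inv_smul_circleIntegral_sub_sq_inv_smul_of_differentiable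
      isOpen_univ (Set.subset_univ _) hg.differentiableOn (mem_ball_self hr)).symm
  have hcont : ∀ g : ℂ → ℂ, Differentiable ℂ g → Continuous fun θ : ℝ =>
      deriv (circleMap z r) θ • (((circleMap z r θ - z) ^ 2)⁻¹ • g (circleMap z r θ)) := by
    intro g hg
    have e1 : Continuous fun θ : ℝ => deriv (circleMap z r) θ := by
      simp only [deriv_circleMap]; fun_prop
    have e2 : Continuous fun θ : ℝ => ((circleMap z r θ - z) ^ 2)⁻¹ := by
      refine Continuous.inv₀ (by fun_prop) fun θ => ?_
      refine pow_ne_zero 2 (sub_ne_zero.2 ?_)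
      exact circleMap_ne_center hr.ne'
    exact e1.smul (e2.smul (hg.continuous.comp (continuous_circleMap z r)))
  have main := intervalIntegral.hasDerivAt_integral_of_dominated_loc_of_deriv_le
    (μ := MeasureTheory.volume) (a := 0) (b := 2 * Real.pi) (x₀ := t) (s := ball t r)
    (F := fun s θ => deriv (circleMap z r) θ •
      (((circleMap z r θ - z) ^ 2)⁻¹ • H s (circleMap z r θ)))
    (F' := fun s θ => deriv (circleMap z r) θ •
      (((circleMap z r θ - z) ^ 2)⁻¹ • H' s (circleMap z r θ)))
    (bound := fun _ => r * ((r ^ 2)⁻¹ * (C / r)))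
    (ball_mem_nhds t hr)
    (Eventually.of_forall fun s => (hcont _ (hH s)).aestronglyMeasurable)
    ((hcont _ (hH t)).intervalIntegrable _ _)
    (hcont _ (hH' t)).aestronglyMeasurable
    (Eventually.of_forall fun θ _ s hs => ?_) (intervalIntegrable_const)
    (Eventually.of_forall fun θ _ s hs => ?_)
  · have := main.2.const_smul ((2 * Real.pi * Complex.I : ℂ)⁻¹)
    rw [← cauchy _ (hH' t)] at this
    refine this.congr_of_eventuallyEq (Eventually.of_forall fun s => ?_)
    exact cauchy _ (hH s)
  · rw [norm_smul, norm_smul, norm_inv, norm_pow, deriv_circleMap, norm_mul, norm_circleMap_zero,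
      Complex.norm_I, mul_one, abs_of_pos hr]
    have e : ‖circleMap z r θ - z‖ = r := by
      simpa [mem_sphere_iff_norm] using circleMap_mem_sphere z hr.le θ
    rw [e]
    -- Cauchy's estimate in `t` on the circle of radius `r = ε / 2` about `s`, which stays inside
    -- `ball t ε`, supplies the dominating constant.
    have hd' : ‖H' s (circleMap z r θ)‖ ≤ C / r := by
      have hball : ∀ v ∈ closedBall s r, v ∈ ball t ε := fun v hv => by
        rw [mem_closedBall] at hv
        rw [mem_ball] at hs ⊢
        linarith [dist_triangle v s t]
      rw [← (hd s (hV' (ball_subset_ball h2 (hball s (mem_closedBall_self hr.le)))) _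
        (hU' (ball_subset_ball h3 (hcirc θ)))).deriv]
      refine Complex.norm_deriv_le_of_forall_mem_sphere_norm_le hr
        (DifferentiableOn.diffContOnCl_ball (U := ball t ε) ?_ hball) ?_
      · intro v hv
        exact (hd v (hV' (ball_subset_ball h2 hv)) _
          (hU' (ball_subset_ball h3 (hcirc θ)))).differentiableAt.differentiableWithinAt
      · intro v hv
        exact hC v (ball_subset_ball h1 (hball v (sphere_subset_closedBall hv))) _
          (ball_subset_ball h1 (hcirc θ))
    gcongr
  · have hs' : s ∈ V := hV' (ball_subset_ball (by linarith) hs)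
    exact ((hd s hs' _ (hU' (ball_subset_ball h3 (hcirc θ)))).const_smul
      ((circleMap z r θ - z) ^ 2)⁻¹).const_smul (deriv (circleMap z r) θ)

lemma differentiable_iteratedDeriv_of_entire {g : ℂ → ℂ} (hg : Differentiable ℂ g) (n : ℕ) :
    Differentiable ℂ (iteratedDeriv n g) := by
  induction n with
  | zero => simpa using hg
  | succ n ih =>
    rw [iteratedDeriv_succ]
    exact differentiableOn_univ.1 (ih.differentiableOn.deriv isOpen_univ)

lemma IsEntireCaloric.locallyBounded_iteratedDeriv {F : ℂ → ℂ → ℂ} (hF : IsEntireCaloric F)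
    {V U : Set ℂ} (hb : LocallyBounded F V U) (j : ℕ) :
    LocallyBounded (fun t => iteratedDeriv j (F t)) V U := by
  induction j with
  | zero => simpa using hb
  | succ j ih =>
    simp only [iteratedDeriv_succ]
    exact ih.deriv fun t => differentiable_iteratedDeriv_of_entire (hF.entire_z t) j

lemma IsEntireCaloric.hasDerivAt_iteratedDeriv_of_locallyBounded {F : ℂ → ℂ → ℂ}
    (hF : IsEntireCaloric F) {V U : Set ℂ} (hV : IsOpen V) (hU : IsOpen U)
    (hb : LocallyBounded F V U) (j : ℕ) :
    ∀ t ∈ V, ∀ z ∈ U, HasDerivAt (fun s => iteratedDeriv j (F s) z)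
      (iteratedDeriv (j + 2) (F t) z) t := by
  induction j with
  | zero =>
    intro t _ z _
    simp only [iteratedDeriv_zero, zero_add]
    rw [← hF.heat t z]
    exact (hF.entire_t z t).hasDerivAt
  | succ j ih =>
    intro t ht z hz
    rw [show j + 1 + 2 = (j + 2) + 1 by ring, iteratedDeriv_succ]
    simp only [iteratedDeriv_succ (n := j)]
    exact hasDerivAt_deriv_of_locallyBounded hV hU (hF.locallyBounded_iteratedDeriv hb j)
      (fun t => differentiable_iteratedDeriv_of_entire (hF.entire_z t) j)
      (fun t => differentiable_iteratedDeriv_of_entire (hF.entire_z t) (j + 2)) ih ht hz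

lemma IsEntireCaloric.iteratedDeriv_t_of_locallyBounded {F : ℂ → ℂ → ℂ}
    (hF : IsEntireCaloric F) {V U : Set ℂ} (hV : IsOpen V) (hU : IsOpen U)
    (hb : LocallyBounded F V U) (j k : ℕ) :
    ∀ t ∈ V, ∀ z ∈ U, iteratedDeriv k (fun s => iteratedDeriv j (F s) z) t =
      iteratedDeriv (2 * k + j) (F t) z := by
  induction k with
  | zero => intro t _ z _; simp
  | succ k ih =>
    intro t ht z hz
    rw [iteratedDeriv_succ, EventuallyEq.deriv_eq
      (f := fun s => iteratedDeriv (2 * k + j) (F s) z)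
      (by filter_upwards [hV.mem_nhds ht] with s hs using ih s hs z hz),
      (hF.hasDerivAt_iteratedDeriv_of_locallyBounded hV hU hb (2 * k + j) t ht z hz).deriv]
    congr 1; ring

/-- Baire in `t`: the closed sets where `|F(t, z)| ≤ N` for all `|z| ≤ 1` cover the plane, so one of
them has interior. -/
lemma IsEntireCaloric.exists_locallyBounded {F : ℂ → ℂ → ℂ} (hF : IsEntireCaloric F) :
    ∃ V : Set ℂ, IsOpen V ∧ V.Nonempty ∧ LocallyBounded F V (ball 0 1) := by
  obtain ⟨N, hN⟩ := nonempty_interior_of_iUnion_of_closed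
    (f := fun N : ℕ => ⋂ z ∈ closedBall (0 : ℂ) 1, {t | ‖F t z‖ ≤ N})
    (fun N => isClosed_biInter fun z _ =>
      isClosed_le (hF.entire_t z).continuous.norm continuous_const) (by
      refine Set.eq_univ_of_forall fun t => ?_
      obtain ⟨C, hC⟩ := (isCompact_closedBall (0 : ℂ) 1).exists_bound_of_continuousOn
        (hF.entire_z t).continuous.continuousOn
      obtain ⟨N, hN⟩ := exists_nat_ge C
      exact Set.mem_iUnion.2 ⟨N, Set.mem_iInter₂.2 fun z hz => (hC z hz).trans hN⟩)
  refine ⟨_, isOpen_interior, hN, fun t ht z hz => ?_⟩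
  obtain ⟨ε₁, hε₁, h1⟩ := Metric.isOpen_iff.1 isOpen_interior t ht
  obtain ⟨ε₂, hε₂, h2⟩ := Metric.isOpen_iff.1 isOpen_ball z hz
  refine ⟨min ε₁ ε₂, by positivity, N, fun s hs w hw => ?_⟩
  exact Set.mem_iInter₂.1 (interior_subset (h1 (ball_subset_ball (min_le_left _ _) hs))) w
    (ball_subset_closedBall (h2 (ball_subset_ball (min_le_right _ _) hw)))

/-- If all series `∑ f⁽²ᵏ⁾(z) tᵏ / k!` with `|z| < 1` converge for all `t`, then `f` has growth
at most of order `2` and minimal type. -/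
lemma typeLE_two_zero_of_pointwise {f : ℂ → ℂ} (hf : Differentiable ℂ f)
    (h : ∀ ε > 0, ∀ z ∈ ball (0 : ℂ) 1, ∃ N : ℝ, ∀ k : ℕ,
      ‖iteratedDeriv (2 * k) f z‖ ≤ N * (k.factorial * ε ^ k)) : TypeLE f 2 0 := by
  suffices H : ∀ T > 0, TypeLE f 2 T from fun B hB => H (B / 2) (by positivity) B (by linarith)
  intro T hT
  set l := derivRate 2 T with hl
  have hl0 : 0 < l := derivRate_pos two_pos hT
  -- The rate of even derivatives for order `2` and type `T`; the weight `(k^k)^(2(1-1/2)) = k^k`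
  -- matches `k!`.
  set ε : ℝ := l ^ 2 * 4 ^ (1 - 1 / 2 : ℝ) with hε
  have hε0 : 0 < ε := by positivity
  -- Baire in `z`. Adding the complement of the disc makes the sets cover the plane; density then
  -- places an interior point inside the disc.
  have hd := dense_iUnion_interior_of_closed
    (f := fun N : ℕ => (⋂ k : ℕ, {z | ‖iteratedDeriv (2 * k) f z‖ ≤ N * (k.factorial * ε ^ k)}) ∪
      (ball (0 : ℂ) 1)ᶜ)
    (fun N => (isClosed_iInter fun k => isClosed_le
      (differentiable_iteratedDeriv_of_entire hf (2 * k)).continuous.norm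
      continuous_const).union isOpen_ball.isClosed_compl) (by
      refine Set.eq_univ_of_forall fun z => ?_
      by_cases hz : z ∈ ball (0 : ℂ) 1
      · obtain ⟨C, hC⟩ := h ε hε0 z hz
        obtain ⟨N, hN⟩ := exists_nat_ge C
        exact Set.mem_iUnion.2 ⟨N, Or.inl (Set.mem_iInter.2 fun k => (hC k).trans (by gcongr))⟩
      · exact Set.mem_iUnion.2 ⟨0, Or.inr hz⟩)
  obtain ⟨z₁, hz₁, hz₁'⟩ := hd.inter_open_nonempty _ isOpen_ball ⟨0, mem_ball_self one_pos⟩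
  obtain ⟨N, hN⟩ := Set.mem_iUnion.1 hz₁'
  obtain ⟨r, hr, hsub⟩ := Metric.isOpen_iff.1 (isOpen_interior.inter isOpen_ball) z₁ ⟨hN, hz₁⟩
  have hbd : ∀ z ∈ ball z₁ r, ∀ k : ℕ,
      ‖iteratedDeriv (2 * k) f z‖ ≤ N * (k.factorial * ε ^ k) := by
    intro z hz k
    obtain ⟨h1, h2⟩ := hsub hz
    rcases interior_subset h1 with h3 | h3
    · exact Set.mem_iInter.1 h3 k
    · exact absurd h2 h3
  have hfac : ∀ k : ℕ, (k.factorial : ℝ) ≤ (k : ℝ) ^ k := fun k => by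
    exact_mod_cast Nat.factorial_le_pow k
  refine typeLE_of_seqLE hf two_pos hT.le z₁ (SeqLE.of_even_odd hl0.le ?_ ?_)
  · intro μ hμ
    have hμ0 : 0 < μ := hε0.trans hμ
    refine ⟨N, fun k => (hbd z₁ (mem_ball_self hr) k).trans ?_⟩
    rw [show (2 * (1 - 1 / 2) : ℝ) = 1 by norm_num, Real.rpow_one, mul_assoc,
      mul_comm (k.factorial : ℝ)]
    have := hμ.le
    gcongr
    exact hfac k
  · intro μ hμ
    have hμ0 : 0 < μ := hε0.trans hμ
    -- Odd derivatives come from even ones by Cauchy's estimate, for which uniformity on a whole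
    -- disc is needed.
    refine ⟨N / (r / 2), fun k => ?_⟩
    simp only [iteratedDeriv_succ]
    refine (Complex.norm_deriv_le_of_forall_mem_sphere_norm_le (R := r / 2) (by positivity)
      (differentiable_iteratedDeriv_of_entire hf (2 * k)).diffContOnCl fun z hz =>
        hbd z (closedBall_subset_ball (by linarith) (sphere_subset_closedBall hz)) k).trans ?_
    rw [show (2 * (1 - 1 / 2) : ℝ) = 1 by norm_num, Real.rpow_one, mul_comm (k.factorial : ℝ),
      mul_div_right_comm, mul_assoc]
    have := hμ.le
    gcongr
    exact hfac k

/-- On a strip of good times `F(t₁, ·)` has at most order `2` and minimal type. Hence `∑ ∂_z^(2k)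
F(t₁, z) (t - t₁)^k / k!` converges uniformly on bounded sets. It equals `F` for `|z| < 1` and so,
by the identity theorem in `z`, everywhere. -/
lemma IsEntireCaloric.locallyBounded {F : ℂ → ℂ → ℂ} (hF : IsEntireCaloric F) :
    LocallyBounded F Set.univ Set.univ := by
  obtain ⟨V, hV, ⟨t₁, ht₁⟩, hb⟩ := hF.exists_locallyBounded
  have hder : ∀ z ∈ ball (0 : ℂ) 1, ∀ k : ℕ,
      iteratedDeriv k (fun s => F s z) t₁ = iteratedDeriv (2 * k) (F t₁) z := fun z hz k => by
    simpa using hF.iteratedDeriv_t_of_locallyBounded hV isOpen_ball hb 0 k t₁ ht₁ z hz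
  have htype : TypeLE (F t₁) 2 0 := by
    refine typeLE_two_zero_of_pointwise (hF.entire_z t₁) fun ε hε z hz => ?_
    obtain ⟨C, hC⟩ := (isCompact_closedBall t₁ ε⁻¹).exists_bound_of_continuousOn
      (hF.entire_t z).continuous.continuousOn
    refine ⟨C, fun k => ?_⟩
    rw [← hder z hz]
    refine (Complex.norm_iteratedDeriv_le_of_forall_mem_sphere_norm_le k (inv_pos.2 hε)
      (hF.entire_t z).diffContOnCl fun t ht => hC t (sphere_subset_closedBall ht)).trans_eq ?_
    rw [inv_pow]; field_simp
  have bound : ∀ R ≥ 1, ∀ S > 0, ∃ C : ℝ, ∀ t ∈ closedBall t₁ S, ∀ z ∈ ball (0 : ℂ) R,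
      ‖F t z‖ ≤ C := by
    intro R hR S hS
    -- Chosen to make the ratio of the majorising geometric series `1/2`.
    set μ : ℝ := √(1 / (4 * Real.exp 1 * S)) with hμ
    have hμ0 : 0 < μ := by positivity
    obtain ⟨C, hC1, hC⟩ := htype.exists_norm_iteratedDeriv_le (hF.entire_z t₁) two_pos le_rfl
      (by linarith : 0 ≤ R) (μ := μ) (by rw [derivRate_zero two_pos]; exact hμ0)
    have hμ2 : μ ^ 2 * 2 * Real.exp 1 * S = 1 / 2 := by
      rw [hμ, Real.sq_sqrt (by positivity)]; field_simp; norm_num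
    have hterm : ∀ t ∈ closedBall t₁ S, ∀ z ∈ ball (0 : ℂ) R, ∀ k : ℕ,
        ‖(k.factorial : ℂ)⁻¹ • (t - t₁) ^ k • iteratedDeriv (2 * k) (F t₁) z‖ ≤
          C * (1 / 2) ^ k := by
      intro t ht z hz k
      rw [norm_smul, norm_smul, norm_inv, norm_pow, Complex.norm_natCast]
      rw [mem_closedBall, dist_eq_norm] at ht
      have h1 := hC z (mem_ball_zero_iff.1 hz).le (2 * k)
      have hfac : (k.factorial : ℝ)⁻¹ ≤ Real.exp k * ((k : ℝ) ^ k)⁻¹ := by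
        have hw := self_pow_pos k
        have := inv_anti₀ (by positivity) (self_pow_mul_exp_le_factorial k)
        rwa [mul_inv, Real.exp_neg, inv_inv, mul_comm] at this
      have hw := self_pow_pos k
      have h4 : (4 : ℝ) ^ (1 - 1 / 2 : ℝ) = 2 := by
        rw [show (4 : ℝ) = 2 ^ (2 : ℝ) by norm_num, ← Real.rpow_mul two_pos.le]; norm_num
      rw [self_pow_two_mul_rpow, h4, show (2 * (1 - 1 / 2) : ℝ) = 1 by norm_num,
        Real.rpow_one] at h1
      calc (k.factorial : ℝ)⁻¹ * (‖t - t₁‖ ^ k * ‖iteratedDeriv (2 * k) (F t₁) z‖)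
          ≤ Real.exp k * ((k : ℝ) ^ k)⁻¹ * (S ^ k * (C * μ ^ (2 * k) * (2 ^ k * (k : ℝ) ^ k))) := by
            gcongr
        _ = C * (μ ^ 2 * 2 * Real.exp 1 * S) ^ k := by
            rw [mul_pow, mul_pow, mul_pow, ← pow_mul, ← Real.exp_nat_mul, mul_one]
            field_simp
        _ = _ := by rw [hμ2]
    have hsum : Summable fun k : ℕ => C * (1 / 2 : ℝ) ^ k := summable_geometric_two.mul_left C
    refine ⟨C * 2, fun t ht z hz => ?_⟩
    have heq : Set.EqOn (F t) (fun z => ∑' k : ℕ,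
        (k.factorial : ℂ)⁻¹ • (t - t₁) ^ k • iteratedDeriv (2 * k) (F t₁) z) (ball 0 R) := by
      refine AnalyticOnNhd.eqOn_of_preconnected_of_eventuallyEq
        ((hF.entire_z t).differentiableOn.analyticOnNhd isOpen_ball) ?_
        (convex_ball 0 R).isPreconnected (z₀ := 0) (mem_ball_self (by linarith)) ?_
      · refine DifferentiableOn.analyticOnNhd ?_ isOpen_ball
        exact Complex.differentiableOn_tsum_of_summable_norm hsum (fun k =>
          (((differentiable_iteratedDeriv_of_entire (hF.entire_z t₁) (2 * k)).fun_const_smul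
            _).fun_const_smul _).differentiableOn) isOpen_ball fun k z hz => hterm t ht z hz k
      · filter_upwards [isOpen_ball.mem_nhds (mem_ball_self one_pos)] with z hz
        have := Complex.hasSum_taylorSeries_of_entire (hF.entire_t z) t₁ t
        simp only [hder z hz] at this
        exact this.tsum_eq.symm
    rw [heq hz]
    exact tsum_of_norm_bounded (hasSum_geometric_two.mul_left C) (hterm t ht z hz)
  intro t _ z _
  obtain ⟨C, hC⟩ := bound (‖z‖ + 1) (by linarith [norm_nonneg z]) (dist t t₁ + 1) (by positivity)
  refine ⟨1, one_pos, C, fun s hs w hw => hC s ?_ w ?_⟩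
  · rw [mem_ball] at hs
    rw [mem_closedBall]
    linarith [dist_triangle s t t₁]
  · rw [mem_ball] at hw
    rw [mem_ball, dist_zero_right]
    have := norm_le_norm_add_norm_sub z w
    rw [← dist_eq_norm, dist_comm] at this
    linarith

theorem IsEntireCaloric.hasDerivAt_iteratedDeriv {F : ℂ → ℂ → ℂ} (hF : IsEntireCaloric F)
    (j : ℕ) (t z : ℂ) :
    HasDerivAt (fun s => iteratedDeriv j (F s) z) (iteratedDeriv (j + 2) (F t) z) t :=
  hF.hasDerivAt_iteratedDeriv_of_locallyBounded isOpen_univ isOpen_univ hF.locallyBounded j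
    t trivial z trivial

theorem IsEntireCaloric.iteratedDeriv_t {F : ℂ → ℂ → ℂ} (hF : IsEntireCaloric F)
    (j k : ℕ) (t z : ℂ) :
    iteratedDeriv k (fun s => iteratedDeriv j (F s) z) t = iteratedDeriv (2 * k + j) (F t) z :=
  hF.iteratedDeriv_t_of_locallyBounded isOpen_univ isOpen_univ hF.locallyBounded j k
    t trivial z trivial

/-! ### Transfer of order and type between `z` and `t` -/

lemma TypeLE.of_lt {g : ℂ → ℂ} {σ σ' T : ℝ} (hσ : 0 < σ) (hT : 0 ≤ T) (h : TypeLE g σ T)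
    (hlt : σ < σ') : TypeLE g σ' 0 := by
  intro B hB
  obtain ⟨C, hC1, hC⟩ := (h (T + 1) (by linarith)).exists_one_le
  obtain ⟨x₀, hx₀⟩ := eventually_atTop.1
    ((tendsto_rpow_atTop (sub_pos.2 hlt)).eventually_ge_atTop ((T + 1) / B))
  set x₁ := max x₀ 1 with hx₁
  have hx₁0 : 0 < x₁ := lt_of_lt_of_le one_pos (le_max_right _ _)
  refine ⟨C * Real.exp ((T + 1) * x₁ ^ σ), fun z => (hC z).trans ?_⟩
  rw [mul_assoc, ← Real.exp_add]
  have key : (T + 1) * ‖z‖ ^ σ ≤ (T + 1) * x₁ ^ σ + B * ‖z‖ ^ σ' := by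
    rcases le_total ‖z‖ x₁ with hz | hz
    · calc (T + 1) * ‖z‖ ^ σ ≤ (T + 1) * x₁ ^ σ := by gcongr
        _ ≤ _ := le_add_of_nonneg_right (by positivity)
    · have hz0 : 0 < ‖z‖ := hx₁0.trans_le hz
      have := hx₀ ‖z‖ ((le_max_left _ _).trans hz)
      rw [div_le_iff₀ hB] at this
      calc (T + 1) * ‖z‖ ^ σ ≤ (‖z‖ ^ (σ' - σ) * B) * ‖z‖ ^ σ := by gcongr
        _ = B * ‖z‖ ^ σ' := by
          rw [mul_comm _ B, mul_assoc, ← Real.rpow_add hz0, sub_add_cancel]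
        _ ≤ _ := le_add_of_nonneg_left (by positivity)
  gcongr

/-- The type in `t` of a caloric function with `z`-order `σ` and `z`-type `T`. -/
def timeType (σ T : ℝ) : ℝ := (1 - σ / 2) * (2 * σ) ^ (σ / (2 - σ)) * T ^ (2 / (2 - σ))

lemma timeType_nonneg {σ T : ℝ} (hσ : 0 < σ) (hσ2 : σ < 2) (hT : 0 ≤ T) : 0 ≤ timeType σ T := by
  have : 0 < 1 - σ / 2 := by linarith
  unfold timeType; positivity

lemma one_sub_inv_timeOrder {σ : ℝ} (hσ : 0 < σ) (hσ2 : σ < 2) :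
    1 - 1 / (σ / (2 - σ)) = 2 * (1 - 1 / σ) := by
  have : 2 - σ ≠ 0 := by linarith
  field_simp; ring

/-- This identity determines the formula for `timeType`: the right side is the rate left after
keeping every second derivative. -/
lemma derivRate_timeType {σ T : ℝ} (hσ : 0 < σ) (hσ2 : σ < 2) (hT : 0 ≤ T) :
    derivRate (σ / (2 - σ)) (timeType σ T) = derivRate σ T ^ 2 * 4 ^ (1 - 1 / σ) := by
  have h2 : 0 < 2 - σ := by linarith
  have h1 : 0 < 1 - σ / 2 := by linarith
  have hs : 0 < σ / (2 - σ) := by positivity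
  rcases hT.eq_or_lt with rfl | hT
  · rw [timeType, Real.zero_rpow (by positivity), mul_zero, derivRate_zero hs, derivRate_zero hσ]
    simp
  · have hΦ : 0 < timeType σ T := by unfold timeType; positivity
    -- After taking logarithms the claim is linear in the logarithms of `2`, `σ`, `2 - σ` and `T`.
    refine Real.log_injOn_pos (derivRate_pos hs hΦ)
      (mul_pos (pow_pos (derivRate_pos hσ hT) 2) (by positivity)) ?_
    have l4 : Real.log 4 = 2 * Real.log 2 := by
      rw [show (4 : ℝ) = 2 ^ 2 by norm_num, Real.log_pow]; norm_num
    rw [Real.log_mul (pow_pos (derivRate_pos hσ hT) 2).ne' (by positivity), Real.log_pow,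
      derivRate, derivRate, Real.log_div (by positivity) (Real.exp_pos 1).ne',
      Real.log_div (by positivity) (Real.exp_pos 1).ne', Real.log_rpow (by positivity),
      Real.log_rpow (by positivity), Real.log_rpow (by positivity), l4,
      Real.log_mul (by positivity) hs.ne', Real.log_mul (Real.exp_pos 1).ne' hΦ.ne',
      Real.log_mul (by positivity) hσ.ne', Real.log_mul (Real.exp_pos 1).ne' hT.ne', Real.log_exp,
      timeType, Real.log_mul (by positivity) (by positivity),
      Real.log_mul (by positivity) (by positivity), Real.log_rpow (by positivity),
      Real.log_rpow hT, Real.log_mul two_ne_zero hσ.ne', Real.log_div hσ.ne' h2.ne',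
      show 1 - σ / 2 = (2 - σ) / 2 by ring, Real.log_div h2.ne' two_ne_zero]
    push_cast
    field_simp
    ring

/-- The function `t ↦ ∂_z^p F(t, z)`. -/
def tSliceDeriv (F : ℂ → ℂ → ℂ) (p : ℕ) (z : ℂ) : ℂ → ℂ := fun t => iteratedDeriv p (F t) z

lemma tSliceDeriv_zero (F : ℂ → ℂ → ℂ) (z : ℂ) : tSliceDeriv F 0 z = tSlice F z := by
  ext; simp [tSliceDeriv, tSlice]

lemma tSliceDeriv_one (F : ℂ → ℂ → ℂ) (z : ℂ) : tSliceDeriv F 1 z = tSliceDz F z := by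
  ext; simp [tSliceDeriv, tSliceDz]

section Caloric

variable {F : ℂ → ℂ → ℂ}

lemma IsEntireCaloric.differentiable_tSliceDeriv (hF : IsEntireCaloric F) (p : ℕ) (z : ℂ) :
    Differentiable ℂ (tSliceDeriv F p z) :=
  fun t => (hF.hasDerivAt_iteratedDeriv p t z).differentiableAt

lemma IsEntireCaloric.typeLE_tSliceDeriv_iff (hF : IsEntireCaloric F) (t₀ z : ℂ) (p : ℕ)
    {σ T : ℝ} (hσ : 0 < σ) (hσ2 : σ < 2) (hT : 0 ≤ T) :
    TypeLE (tSliceDeriv F p z) (σ / (2 - σ)) (timeType σ T) ↔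
      SeqLE (fun k => iteratedDeriv (2 * k + p) (F t₀) z) (2 * (1 - 1 / σ))
        (derivRate σ T ^ 2 * 4 ^ (1 - 1 / σ)) := by
  have h2 : 0 < 2 - σ := by linarith
  rw [typeLE_iff_seqLE (hF.differentiable_tSliceDeriv p z) (by positivity)
    (timeType_nonneg hσ hσ2 hT) t₀, one_sub_inv_timeOrder hσ hσ2, derivRate_timeType hσ hσ2 hT]
  have e : (fun k => iteratedDeriv k (tSliceDeriv F p z) t₀) =
      fun k => iteratedDeriv (2 * k + p) (F t₀) z :=
    funext fun k => hF.iteratedDeriv_t p k t₀ z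
  rw [e]

/-- Even derivatives are the `t`-coefficients of `F`, odd ones those of `∂_z F`; together they are
all derivatives of `F(t₀, ·)` at `z`. -/
theorem IsEntireCaloric.typeLE_iff (hF : IsEntireCaloric F) (t₀ z : ℂ)
    {σ T : ℝ} (hσ : 0 < σ) (hσ2 : σ < 2) (hT : 0 ≤ T) :
    TypeLE (F t₀) σ T ↔
      TypeLE (tSliceDeriv F 0 z) (σ / (2 - σ)) (timeType σ T) ∧
      TypeLE (tSliceDeriv F 1 z) (σ / (2 - σ)) (timeType σ T) := by
  rw [hF.typeLE_tSliceDeriv_iff t₀ z 0 hσ hσ2 hT, hF.typeLE_tSliceDeriv_iff t₀ z 1 hσ hσ2 hT,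
    typeLE_iff_seqLE (hF.entire_z t₀) hσ hT z]
  have hl := derivRate_nonneg hσ.le hT
  exact ⟨fun h => ⟨h.even hl, h.odd hl⟩, fun h => SeqLE.of_even_odd hl h.1 h.2⟩

lemma caloricTOrder_eq (F : ℂ → ℂ → ℂ) (z : ℂ) : caloricTOrder F z =
    max (entireOrder (tSliceDeriv F 0 z)) (entireOrder (tSliceDeriv F 1 z)) := by
  rw [tSliceDeriv_zero, tSliceDeriv_one, caloricTOrder]

lemma timeType_zero {σ : ℝ} (hσ2 : σ < 2) : timeType σ 0 = 0 := by
  have h2 : 0 < 2 - σ := by linarith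
  rw [timeType, Real.zero_rpow (by positivity), mul_zero]

lemma timeOrder_lt {a σ : ℝ} (h : a < σ) (hσ : σ < 2) :
    a / (2 - a) < σ / (2 - σ) := by
  rw [div_lt_div_iff₀ (by linarith) (by linarith)]
  nlinarith

lemma exists_timeOrder_eq {s : ℝ} (hs : 0 < s) : ∃ σ, 0 < σ ∧ σ < 2 ∧ σ / (2 - σ) = s := by
  have h1 : 0 < 1 + s := by linarith
  refine ⟨2 * s / (1 + s), by positivity, ?_, ?_⟩
  · rw [div_lt_iff₀ h1]; linarith
  · have : 2 - 2 * s / (1 + s) = 2 / (1 + s) := by field_simp; ring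
    rw [this]; field_simp

lemma IsEntireCaloric.typeLE_zero_iff (hF : IsEntireCaloric F) (t₀ z : ℂ)
    {σ : ℝ} (hσ : 0 < σ) (hσ2 : σ < 2) :
    TypeLE (F t₀) σ 0 ↔ TypeLE (tSliceDeriv F 0 z) (σ / (2 - σ)) 0 ∧
      TypeLE (tSliceDeriv F 1 z) (σ / (2 - σ)) 0 := by
  rw [hF.typeLE_iff t₀ z hσ hσ2 le_rfl, timeType_zero hσ2]

theorem IsEntireCaloric.entireOrder_le_iff (hF : IsEntireCaloric F) (t₀ z : ℂ) {a : ℝ}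
    (ha : 0 ≤ a) (ha2 : a < 2) :
    entireOrder (F t₀) ≤ ENNReal.ofReal a ↔
      caloricTOrder F z ≤ ENNReal.ofReal (a / (2 - a)) := by
  have h2 : 0 < 2 - a := by linarith
  have hs : 0 ≤ a / (2 - a) := by positivity
  rw [caloricTOrder_eq, max_le_iff,
    CaloricGrowth.entireOrder_le_iff (hF.differentiable_tSliceDeriv 0 z) hs,
    CaloricGrowth.entireOrder_le_iff (hF.differentiable_tSliceDeriv 1 z) hs,
    CaloricGrowth.entireOrder_le_iff (hF.entire_z t₀) ha, ← forall₂_and]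
  constructor
  · intro h s hs'
    obtain ⟨σ, hσ0, hσ2, rfl⟩ := exists_timeOrder_eq (hs.trans_lt hs')
    refine (hF.typeLE_zero_iff t₀ z hσ0 hσ2).1 (h σ ?_)
    by_contra! hle
    rcases hle.eq_or_lt with rfl | hlt
    · exact lt_irrefl _ hs'
    · exact lt_asymm hs' (timeOrder_lt hlt ha2)
  · intro h σ hσ
    -- The correspondence needs an order below `2`, which `σ` may exceed.
    obtain ⟨σ', h1, h2⟩ := exists_between (lt_min hσ ha2)
    have h3 := h2.trans_le (min_le_right _ _)
    exact ((hF.typeLE_zero_iff t₀ z (ha.trans_lt h1) h3).2 (h _ (timeOrder_lt h1 h3))).of_lt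
      (ha.trans_lt h1) le_rfl (h2.trans_le (min_le_left _ _))

theorem IsEntireCaloric.caloricTOrder_eq_ofReal (hF : IsEntireCaloric F) (t₀ z : ℂ) {ρ : ℝ}
    (hρ0 : 0 < ρ) (hρ2 : ρ < 2) (hρ : entireOrder (F t₀) = ENNReal.ofReal ρ) :
    caloricTOrder F z = ENNReal.ofReal (ρ / (2 - ρ)) := by
  have h2 : 0 < 2 - ρ := by linarith
  refine le_antisymm ((hF.entireOrder_le_iff t₀ z hρ0.le hρ2).1 hρ.le) ?_
  by_contra! hlt
  obtain ⟨b, hb1, hb2⟩ := exists_between hlt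
  lift b to NNReal using hb2.ne_top
  -- A `t`-order bound `b > 0` is the image of some `σ` in `(0, 2)`; `b = 0` is not and uses `a = 0`
  -- directly.
  rcases eq_zero_or_pos b with rfl | hb0
  · have := (hF.entireOrder_le_iff t₀ z le_rfl two_pos).2 (by simpa using hb1.le)
    rw [hρ] at this
    simp at this
    linarith
  · obtain ⟨σ, hσ0, hσ2, hσ⟩ := exists_timeOrder_eq (NNReal.coe_pos.2 hb0)
    rw [← ENNReal.ofReal_coe_nnreal, ← hσ] at hb1 hb2
    have := (hF.entireOrder_le_iff t₀ z hσ0.le hσ2).2 hb1.le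
    rw [hρ, ENNReal.ofReal_le_ofReal_iff hσ0.le] at this
    have hlt' := (ENNReal.ofReal_lt_ofReal_iff (by positivity)).1 hb2
    rcases this.eq_or_lt with rfl | h'
    · exact lt_irrefl _ hlt'
    · exact lt_asymm hlt' (timeOrder_lt h' hσ2)

end Caloric

/-! ### Two-constants inequality for sets of positive area -/

/-- Sub-mean value property of `log ‖h‖` on circles. -/
lemma log_norm_le_circleAverage {h : ℂ → ℂ} (hh : Differentiable ℂ h) {u : ℂ} (hu : h u ≠ 0)
    {r : ℝ} (hr : 0 < r) :
    Real.log ‖h u‖ ≤ Real.circleAverage (fun z => Real.log ‖h z‖) u r := by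
  have han : AnalyticOnNhd ℂ h (closedBall u |r|) := fun z _ => hh.analyticAt z
  -- Jensen's formula: the excess of the average is a sum over the zeros with nonnegative terms.
  rw [han.circleAverage_log_norm hr.ne' hu]
  refine le_add_of_nonneg_left (finsum_nonneg fun w => ?_)
  by_cases hw : w ∈ closedBall u |r|
  · refine mul_nonneg ?_ ?_
    · exact Int.cast_nonneg (MeromorphicOn.AnalyticOnNhd.divisor_nonneg han w)
    · rw [abs_of_pos hr, mem_closedBall, dist_comm, dist_eq_norm] at hw
      rcases (norm_nonneg (u - w)).eq_or_lt with h0 | h0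
      · simp [← h0]
      · refine Real.log_nonneg ?_
        rw [← div_eq_mul_inv, one_le_div h0]; exact hw
  · rw [Function.locallyFinsuppWithin.apply_eq_zero_of_notMem _ hw]; simp

lemma circleMap_eq_add_polarCoord_symm (u : ℂ) (r θ : ℝ) :
    circleMap u r θ = u + Complex.polarCoord.symm (r, θ) := by
  simp [circleMap, Complex.exp_mul_I]

lemma circleAverage_eq_setIntegral (g : ℂ → ℝ) (u : ℂ) (r : ℝ) :
    Real.circleAverage g u r = (2 * Real.pi)⁻¹ *
      ∫ θ in Set.Ioo (-Real.pi) Real.pi, g (u + Complex.polarCoord.symm (r, θ)) := by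
  rw [Real.circleAverage_eq_integral_add (-Real.pi), smul_eq_mul,
    intervalIntegral.integral_comp_add_right (fun θ => g (circleMap u r θ)),
    intervalIntegral.integral_of_le (by linarith [Real.pi_pos]), integral_Ioc_eq_integral_Ioo]
  simp only [circleMap_eq_add_polarCoord_symm]
  congr 4 <;> ring

lemma circleIntegrable_indicator_add {A : Set ℂ} (hA : MeasurableSet A) (a b : ℝ) (u : ℂ) (r : ℝ) :
    CircleIntegrable (fun z => a + A.indicator (fun _ => b) z) u r := by
  refine (intervalIntegrable_const (c := |a| + |b|)).mono_fun' ?_ ?_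
  · have : Measurable fun z => a + A.indicator (fun _ => b) z :=
      (measurable_const.indicator hA).const_add a
    exact (this.comp (continuous_circleMap u r).measurable).aestronglyMeasurable
  · refine Eventually.of_forall fun θ => ?_
    refine (norm_add_le _ _).trans (add_le_add le_rfl ?_)
    by_cases hz : circleMap u r θ ∈ A <;> simp [hz]

lemma volume_eq_integral_polar {A : Set ℂ} (hA : MeasurableSet A) {u : ℂ} {R : ℝ}
    (hAR : A ⊆ closedBall u R) :
    IntegrableOn (fun r : ℝ => r * ∫ θ in Set.Ioo (-Real.pi) Real.pi,
      A.indicator (fun _ => (1 : ℝ)) (u + Complex.polarCoord.symm (r, θ))) (Set.Ioc 0 R) ∧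
    (∫ r in Set.Ioc 0 R, r * ∫ θ in Set.Ioo (-Real.pi) Real.pi,
      A.indicator (fun _ => (1 : ℝ)) (u + Complex.polarCoord.symm (r, θ))) = volume.real A := by
  set f : ℂ → ℝ := fun w => A.indicator (fun _ => (1 : ℝ)) (u + w) with hf
  have hfm : Measurable f := (measurable_const.indicator hA).comp (measurable_const_add u)
  have hpm : Measurable fun p : ℝ × ℝ => Complex.polarCoord.symm p := by
    simp only [Complex.polarCoord_symm_apply]; fun_prop
  have hprod : IntegrableOn (fun p : ℝ × ℝ => p.1 * f (Complex.polarCoord.symm p))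
      (Set.Ioc 0 R ×ˢ Set.Ioo (-Real.pi) Real.pi) (volume.prod volume) := by
    refine Measure.integrableOn_of_bounded (M := R) ?_ ?_ ?_
    · rw [Measure.prod_prod]
      exact (ENNReal.mul_lt_top measure_Ioc_lt_top measure_Ioo_lt_top).ne
    · exact (measurable_fst.mul (hfm.comp hpm)).aestronglyMeasurable
    · refine ae_restrict_of_forall_mem (measurableSet_Ioc.prod measurableSet_Ioo) fun p hp => ?_
      have h1 : 0 < p.1 := hp.1.1
      rw [norm_mul, Real.norm_of_nonneg h1.le]
      have h2 : ‖f (Complex.polarCoord.symm p)‖ ≤ 1 := by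
        by_cases hz : u + Complex.polarCoord.symm p ∈ A <;> simp only [hf, hz,
          Set.indicator_of_mem, Set.indicator_of_notMem, not_false_eq_true] <;> simp
      calc p.1 * _ ≤ R * 1 := mul_le_mul hp.1.2 h2 (norm_nonneg _) (h1.le.trans hp.1.2)
        _ = R := mul_one R
  have e1 : ∀ r : ℝ, (∫ θ in Set.Ioo (-Real.pi) Real.pi, r * f (Complex.polarCoord.symm (r, θ))) =
      r * ∫ θ in Set.Ioo (-Real.pi) Real.pi, f (Complex.polarCoord.symm (r, θ)) :=
    fun r => integral_const_mul _ _
  constructor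
  · have := hprod
    rw [IntegrableOn, ← Measure.prod_restrict] at this
    have := this.integral_prod_left
    simp only [e1] at this
    exact this
  · have h1 := setIntegral_prod _ hprod
    simp only [e1] at h1
    rw [← h1]
    have h2 := Complex.integral_comp_polarCoord_symm f
    have h3 : ∫ w, f w = volume.real A := by
      rw [hf, integral_add_left_eq_self (fun w => A.indicator (fun _ => (1 : ℝ)) w) u,
        integral_indicator hA]
      simp
    rw [← h3, ← h2]
    refine (setIntegral_eq_of_subset_of_forall_sdiff_eq_zero ?_ ?_ ?_).symm
    · exact measurableSet_Ioi.prod measurableSet_Ioo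
    · exact Set.prod_mono Set.Ioc_subset_Ioi_self subset_rfl
    · rintro p ⟨hp1, hp2⟩
      have hp0 : 0 < p.1 := hp1.1
      have hpR : R < p.1 := by
        by_contra! hle
        exact hp2 ⟨⟨hp0, hle⟩, hp1.2⟩
      have : u + Complex.polarCoord.symm p ∉ A := fun hmem => by
        have := hAR hmem
        rw [mem_closedBall, dist_eq_norm, add_sub_cancel_left, Complex.norm_polarCoord_symm,
          abs_of_pos hp0] at this
        linarith
      simp only [hf, Set.indicator_of_notMem this, mul_zero]

/-- On the disc `log |h|` is at most `log m` on `A` and `log M` elsewhere. Integrating the sub-mean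
inequality over circles with weight `r` weighs these bounds by area. -/
lemma log_norm_le_of_bound_on {h : ℂ → ℂ} (hh : Differentiable ℂ h) {A : Set ℂ}
    (hA : MeasurableSet A) {u : ℂ} {R : ℝ} (hR : 0 < R) (hAR : A ⊆ closedBall u R) {m M : ℝ}
    (hm : 1 ≤ m) (hM : 1 ≤ M) (hmA : ∀ z ∈ A, ‖h z‖ ≤ m) (hMR : ∀ z ∈ closedBall u R, ‖h z‖ ≤ M)
    (hu : h u ≠ 0) :
    Real.log ‖h u‖ ≤ Real.log M + volume.real A / (Real.pi * R ^ 2) * (Real.log m - Real.log M) := by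
  set b := Real.log m - Real.log M with hb
  obtain ⟨hint, hvol⟩ := volume_eq_integral_polar hA hAR
  set φ : ℝ → ℝ := fun r => ∫ θ in Set.Ioo (-Real.pi) Real.pi,
      A.indicator (fun _ => (1 : ℝ)) (u + Complex.polarCoord.symm (r, θ)) with hφ
  have hpi := Real.pi_pos
  have hcirc : ∀ r ∈ Set.Ioc 0 R, 2 * Real.pi * (Real.log ‖h u‖ - Real.log M) ≤ b * φ r := by
    intro r hr
    have h1 := log_norm_le_circleAverage hh hu hr.1
    have h2 : Real.circleAverage (fun z => Real.log ‖h z‖) u r ≤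
        Real.circleAverage (fun z => Real.log M + A.indicator (fun _ => b) z) u r := by
      refine Real.circleAverage_mono
        (MeromorphicOn.circleIntegrable_log_norm fun z _ => (hh.analyticAt z).meromorphicAt)
        (circleIntegrable_indicator_add hA _ _ _ _) fun z hz => ?_
      rw [abs_of_pos hr.1] at hz
      have hzR : z ∈ closedBall u R := by
        rw [mem_sphere] at hz; rw [mem_closedBall, hz]; exact hr.2
      rcases (norm_nonneg (h z)).eq_or_lt with h0 | h0
      -- At zeros of `h` the convention `log 0 = 0` requires `m, M ≥ 1`.
      · rw [← h0, Real.log_zero]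
        by_cases hzA : z ∈ A
        · simp only [Set.indicator_of_mem hzA, hb]
          linarith [Real.log_nonneg hm]
        · simp only [Set.indicator_of_notMem hzA, add_zero]
          exact Real.log_nonneg hM
      · by_cases hzA : z ∈ A
        · simp only [Set.indicator_of_mem hzA, hb]
          linarith [Real.log_le_log h0 (hmA z hzA)]
        · simp only [Set.indicator_of_notMem hzA, add_zero]
          exact Real.log_le_log h0 (hMR z hzR)
    have h3 : Real.circleAverage (fun z => Real.log M + A.indicator (fun _ => b) z) u r =
        Real.log M + (2 * Real.pi)⁻¹ * (b * φ r) := by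
      have e : (fun z => Real.log M + A.indicator (fun _ => b) z) =
          (fun _ => Real.log M) + b • A.indicator (fun _ => (1 : ℝ)) := by
        ext z; by_cases hz : z ∈ A <;> simp [hz]
      have hi : CircleIntegrable (A.indicator (fun _ => (1 : ℝ))) u r := by
        simpa using circleIntegrable_indicator_add hA 0 1 u r
      rw [e, Real.circleAverage_add (circleIntegrable_const _ _ _) hi.const_smul,
        Real.circleAverage_const, Real.circleAverage_smul, circleAverage_eq_setIntegral, smul_eq_mul]
      ring
    have h4 := h1.trans (h2.trans_eq h3)
    have h5 : (2 * Real.pi) * ((2 * Real.pi)⁻¹ * (b * φ r)) = b * φ r := by field_simp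
    have h6 : 2 * Real.pi * (Real.log ‖h u‖ - Real.log M) ≤
        2 * Real.pi * ((2 * Real.pi)⁻¹ * (b * φ r)) := by
      gcongr; linarith
    linarith
  have hint2 : ∫ r in Set.Ioc 0 R, r * (2 * Real.pi * (Real.log ‖h u‖ - Real.log M)) ≤
      ∫ r in Set.Ioc 0 R, b * (r * φ r) := by
    refine setIntegral_mono_on ?_ (hint.const_mul b) measurableSet_Ioc fun r hr => ?_
    · exact ((continuous_id.mul continuous_const).integrableOn_Icc).mono_set Set.Ioc_subset_Icc_self
    · have := mul_le_mul_of_nonneg_left (hcirc r hr) hr.1.le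
      linarith
  rw [integral_const_mul, hvol, integral_mul_const, ← intervalIntegral.integral_of_le hR.le,
    integral_id] at hint2
  have : Real.pi * R ^ 2 * (Real.log ‖h u‖ - Real.log M) ≤ b * volume.real A := by
    linarith
  rw [← le_div_iff₀' (by positivity)] at this
  have e : volume.real A / (Real.pi * R ^ 2) * b = b * volume.real A / (Real.pi * R ^ 2) := by ring
  rw [e]; linarith

/-- Two-constants theorem for a set of positive area. -/
theorem exists_two_constants {A : Set ℂ} (hA : MeasurableSet A) {R : ℝ} (hR : 0 ≤ R)
    (hAR : A ⊆ closedBall 0 R) (hA0 : volume A ≠ 0) :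
    ∃ θ : ℝ, 0 < θ ∧ θ ≤ 1 ∧ ∀ (h : ℂ → ℂ) (m M : ℝ), Differentiable ℂ h → 0 < m → 0 < M →
      (∀ z ∈ A, ‖h z‖ ≤ m) → (∀ z, ‖z‖ ≤ R + 2 → ‖h z‖ ≤ M) →
      ∀ u, ‖u‖ ≤ 1 → ‖h u‖ ≤ m ^ θ * M ^ (1 - θ) := by
  have hfin : volume A ≠ ⊤ := (measure_mono hAR |>.trans_lt measure_closedBall_lt_top).ne
  have hpos : 0 < volume.real A := ENNReal.toReal_pos hA0 hfin
  have hR1 : 0 < R + 1 := by linarith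
  -- For `|u| ≤ 1` the disc of radius `R + 1` about `u` contains `A` and lies in the disc of radius
  -- `R + 2` about `0`, so one `θ` serves all `u`.
  refine ⟨volume.real A / (Real.pi * (R + 1) ^ 2), by positivity, ?_, ?_⟩
  · rw [div_le_one (by positivity)]
    have h1 : volume.real A ≤ volume.real (closedBall (0 : ℂ) (R + 1)) :=
      measureReal_mono (hAR.trans (closedBall_subset_closedBall (by linarith)))
        measure_closedBall_lt_top.ne
    rw [measureReal_def (μ := volume) (s := closedBall (0 : ℂ) (R + 1)),
      Complex.volume_closedBall] at h1
    simp only [ENNReal.toReal_mul, ENNReal.toReal_pow, ENNReal.toReal_ofReal hR1.le,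
      ENNReal.coe_toReal, NNReal.coe_real_pi] at h1
    linarith
  · intro h m M hh hm hM hmA hMR u hu
    set θ := volume.real A / (Real.pi * (R + 1) ^ 2) with hθ
    by_cases hu0 : h u = 0
    · rw [hu0, norm_zero]; positivity
    -- The inequality is homogeneous, so scaling by `c` brings both bounds above `1`.
    set c : ℝ := max m⁻¹ M⁻¹ with hc
    have hc0 : 0 < c := lt_max_of_lt_left (inv_pos.2 hm)
    have hcm : 1 ≤ c * m := by
      calc 1 = m⁻¹ * m := (inv_mul_cancel₀ hm.ne').symm
        _ ≤ _ := by gcongr; exact le_max_left _ _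
    have hcM : 1 ≤ c * M := by
      calc 1 = M⁻¹ * M := (inv_mul_cancel₀ hM.ne').symm
        _ ≤ _ := by gcongr; exact le_max_right _ _
    have hnorm : ∀ z, ‖(c : ℂ) * h z‖ = c * ‖h z‖ := fun z => by
      rw [norm_mul, Complex.norm_real, Real.norm_of_nonneg hc0.le]
    have := log_norm_le_of_bound_on (h := fun z => (c : ℂ) * h z) (hh.const_mul _) hA hR1
      (u := u) (m := c * m) (M := c * M) (fun z hz => by
        have h1 := hAR hz
        rw [mem_closedBall, dist_zero_right] at h1
        rw [mem_closedBall, dist_eq_norm]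
        linarith [norm_sub_le z u]) hcm hcM
      (fun z hz => by rw [hnorm]; gcongr; exact hmA z hz)
      (fun z hz => by
        rw [hnorm]
        rw [mem_closedBall, dist_eq_norm] at hz
        gcongr
        refine hMR z ?_
        linarith [norm_le_norm_add_norm_sub' z u])
      (mul_ne_zero (by exact_mod_cast hc0.ne') hu0)
    have hu0' : 0 < ‖h u‖ := norm_pos_iff.2 hu0
    rw [hnorm, Real.log_mul hc0.ne' hu0'.ne', Real.log_mul hc0.ne' hm.ne',
      Real.log_mul hc0.ne' hM.ne', ← hθ] at this
    rw [← Real.log_le_log_iff hu0' (by positivity), Real.log_mul (by positivity) (by positivity),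
      Real.log_rpow hm, Real.log_rpow hM]
    linarith

/-! ### Exceptional sets have measure zero -/

lemma iteratedDeriv_iteratedDeriv (f : ℂ → ℂ) (n p : ℕ) :
    iteratedDeriv n (iteratedDeriv p f) = iteratedDeriv (n + p) f := by
  simp only [iteratedDeriv_eq_iterate, Function.iterate_add_apply]

lemma SeqLE.shift_iff {c : ℕ → ℂ} {α l : ℝ} (hl : 0 ≤ l) (p : ℕ) :
    SeqLE (fun n => c (n + p)) α l ↔ SeqLE c α l := by
  induction p with
  | zero => rfl
  | succ p ih =>
    rw [← ih]
    have e : (fun n => c (n + (p + 1))) = fun n => (fun m => c (m + p)) (n + 1) := by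
      ext n; congr 1; ring
    rw [e]
    exact ⟨fun h => h.of_shift hl, fun h => h.shift hl⟩

lemma typeLE_iteratedDeriv_iff {f : ℂ → ℂ} (hf : Differentiable ℂ f) (p : ℕ) {σ T : ℝ}
    (hσ : 0 < σ) (hT : 0 ≤ T) : TypeLE (iteratedDeriv p f) σ T ↔ TypeLE f σ T := by
  rw [typeLE_iff_seqLE (differentiable_iteratedDeriv_of_entire hf p) hσ hT 0,
    typeLE_iff_seqLE hf hσ hT 0]
  simp only [iteratedDeriv_iteratedDeriv]
  exact SeqLE.shift_iff (c := fun n => iteratedDeriv n f 0) (derivRate_nonneg hσ.le hT) p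

lemma TypeLE.exists_norm_even_iteratedDeriv_le {g : ℂ → ℂ} {σ T R ν : ℝ} (hg : Differentiable ℂ g)
    (hσ : 0 < σ) (hT : 0 ≤ T) (hR : 0 ≤ R) (h : TypeLE g σ T)
    (hν : derivRate σ T ^ 2 * 4 ^ (1 - 1 / σ) < ν) :
    ∃ C : ℝ, 0 < C ∧ ∀ u : ℂ, ‖u‖ ≤ R → ∀ k : ℕ,
      ‖iteratedDeriv (2 * k) g u‖ ≤ C * ν ^ k * ((k : ℝ) ^ k) ^ (2 * (1 - 1 / σ)) := by
  set α := 1 - 1 / σ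
  have h4 : (0 : ℝ) < 4 ^ α := by positivity
  have hl := derivRate_nonneg hσ.le hT
  have hν0 : 0 < ν := lt_of_le_of_lt (by positivity) hν
  have h1 : derivRate σ T < √(ν / 4 ^ α) := by
    rw [Real.lt_sqrt hl, lt_div_iff₀ h4]; exact hν
  obtain ⟨C, hC1, hC⟩ := h.exists_norm_iteratedDeriv_le hg hσ hT hR h1
  refine ⟨C, by linarith, fun u hu k => (hC u hu (2 * k)).trans_eq ?_⟩
  rw [self_pow_two_mul_rpow, pow_mul, Real.sq_sqrt (by positivity), div_pow]
  have := div_mul_cancel₀ (ν ^ k) (pow_pos h4 k).ne'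
  linear_combination C * ((k : ℝ) ^ k) ^ (2 * α) * this

/-- Bounds for the even derivatives which hold pointwise on a set of positive measure improve
the locally uniform bounds. -/
lemma exists_interpolation {g : ℂ → ℂ} (hg : Differentiable ℂ g) {β₀ ν₀ : ℝ} (hν₀ : 0 < ν₀)
    {Z : Set ℂ} (hZ : ∀ z ∈ Z, ∃ C : ℝ, ∀ k : ℕ,
      ‖iteratedDeriv (2 * k) g z‖ ≤ C * ν₀ ^ k * ((k : ℝ) ^ k) ^ β₀) (hZ0 : volume Z ≠ 0) :
    ∃ θ : ℝ, 0 < θ ∧ θ ≤ 1 ∧ ∀ β₁ ν₁ : ℝ, 0 < ν₁ →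
      (∀ R ≥ 0, ∃ C : ℝ, 0 < C ∧ ∀ z : ℂ, ‖z‖ ≤ R → ∀ k : ℕ,
        ‖iteratedDeriv (2 * k) g z‖ ≤ C * ν₁ ^ k * ((k : ℝ) ^ k) ^ β₁) →
      ∃ C : ℝ, 0 < C ∧ ∀ u : ℂ, ‖u‖ ≤ 1 → ∀ k : ℕ, ‖iteratedDeriv (2 * k) g u‖ ≤
        C * (ν₀ ^ θ * ν₁ ^ (1 - θ)) ^ k * ((k : ℝ) ^ k) ^ (θ * β₀ + (1 - θ) * β₁) := by
  -- Closed bounded sets with uniform constants; they cover `Z`, so one has positive area.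
  set A : ℕ → Set ℂ := fun N => closedBall 0 N ∩
    ⋂ k : ℕ, {z | ‖iteratedDeriv (2 * k) g z‖ ≤ (N + 1) * ν₀ ^ k * ((k : ℝ) ^ k) ^ β₀} with hA
  have hclosed : ∀ N, IsClosed (A N) := fun N => isClosed_closedBall.inter
    (isClosed_iInter fun k => isClosed_le
      (differentiable_iteratedDeriv_of_entire hg (2 * k)).continuous.norm continuous_const)
  obtain ⟨N, hN⟩ : ∃ N, volume (A N) ≠ 0 := by
    by_contra! hall
    refine hZ0 (measure_mono_null (fun z hz => ?_) (measure_iUnion_null hall))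
    obtain ⟨C, hC⟩ := hZ z hz
    obtain ⟨N, hN⟩ := exists_nat_ge (max C ‖z‖)
    refine Set.mem_iUnion.2 ⟨N, ?_, Set.mem_iInter.2 fun k => (hC k).trans ?_⟩
    · simpa using (le_max_right _ _).trans hN
    · have := self_pow_pos k
      have := (le_max_left _ _).trans hN
      gcongr
      linarith
  obtain ⟨θ, hθ0, hθ1, hθ⟩ := exists_two_constants (hclosed N).measurableSet N.cast_nonneg
    Set.inter_subset_left hN
  refine ⟨θ, hθ0, hθ1, fun β₁ ν₁ hν₁ hbd => ?_⟩
  obtain ⟨C, hC0, hC⟩ := hbd (N + 2) (by positivity)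
  refine ⟨((N : ℝ) + 1) ^ θ * C ^ (1 - θ), by positivity, fun u hu k => ?_⟩
  have hw := self_pow_pos k
  refine (hθ (iteratedDeriv (2 * k) g) (((N : ℝ) + 1) * ν₀ ^ k * ((k : ℝ) ^ k) ^ β₀)
    (C * ν₁ ^ k * ((k : ℝ) ^ k) ^ β₁) (differentiable_iteratedDeriv_of_entire hg _)
    (by positivity) (by positivity) (fun z hz => Set.mem_iInter.1 hz.2 k)
    (fun z hz => hC z hz k) u hu).trans_eq ?_
  have hpow : ∀ {x : ℝ} (a : ℝ), 0 < x → (x ^ k) ^ a = (x ^ a) ^ k := fun a hx => by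
    rw [← Real.rpow_natCast, ← Real.rpow_natCast, ← Real.rpow_mul hx.le, ← Real.rpow_mul hx.le,
      mul_comm]
  rw [Real.mul_rpow (by positivity) (by positivity), Real.mul_rpow (by positivity) (by positivity),
    Real.mul_rpow (by positivity) (by positivity), Real.mul_rpow (by positivity) (by positivity),
    hpow _ hν₀, hpow _ hν₁, ← Real.rpow_mul hw.le, ← Real.rpow_mul hw.le, Real.rpow_add hw,
    mul_pow, mul_comm β₀, mul_comm β₁]
  ring

/-- The bound holds on the whole unit disc, so Cauchy's estimate extends it to odd derivatives at
`0`. -/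
lemma typeLE_of_even_bound {g : ℂ → ℂ} (hg : Differentiable ℂ g) {σ T C ν : ℝ} (hσ : 0 < σ)
    (hT : 0 ≤ T) (hν0 : 0 < ν) (hC : 0 < C) (hν : ν ≤ derivRate σ T ^ 2 * 4 ^ (1 - 1 / σ))
    (h : ∀ u : ℂ, ‖u‖ ≤ 1 → ∀ k : ℕ,
      ‖iteratedDeriv (2 * k) g u‖ ≤ C * ν ^ k * ((k : ℝ) ^ k) ^ (2 * (1 - 1 / σ))) :
    TypeLE g σ T := by
  refine typeLE_of_seqLE hg hσ hT 0 (SeqLE.of_even_odd (derivRate_nonneg hσ.le hT) ?_ ?_)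
  · refine fun μ hμ => ⟨C, fun k => (h 0 (by simp) k).trans ?_⟩
    have := self_pow_pos k
    have := hν.trans hμ.le
    gcongr
  · refine fun μ hμ => ⟨C, fun k => ?_⟩
    have hd := Complex.norm_deriv_le_of_forall_mem_sphere_norm_le (c := 0) one_pos
      (differentiable_iteratedDeriv_of_entire hg (2 * k)).diffContOnCl
      (fun z hz => h z (mem_sphere_zero_iff_norm.1 hz).le k)
    rw [← iteratedDeriv_succ, div_one] at hd
    refine hd.trans ?_
    have := self_pow_pos k
    have := hν.trans hμ.le
    gcongr

lemma exists_derivRate_eq {σ l : ℝ} (hσ : 0 < σ) (hl : 0 < l) : ∃ T ≥ 0, derivRate σ T = l := by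
  refine ⟨(Real.exp 1 * l) ^ σ / (Real.exp 1 * σ), by positivity, ?_⟩
  have : Real.exp 1 * ((Real.exp 1 * l) ^ σ / (Real.exp 1 * σ)) * σ = (Real.exp 1 * l) ^ σ := by
    field_simp
  rw [derivRate, this, ← Real.rpow_mul (by positivity), mul_one_div_cancel hσ.ne', Real.rpow_one]
  field_simp

lemma derivRate_eq_mul_rpow {σ T : ℝ} (hσ : 0 < σ) (hT : 0 ≤ T) :
    derivRate σ T = derivRate σ 1 * T ^ (1 / σ) := by
  rw [derivRate, derivRate, show Real.exp 1 * T * σ = Real.exp 1 * 1 * σ * T by ring,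
    Real.mul_rpow (by positivity) hT]
  ring

section Caloric

variable {F : ℂ → ℂ → ℂ}

lemma IsEntireCaloric.typeLE_tSliceDeriv_iff' (hF : IsEntireCaloric F) (t₀ z : ℂ) (p : ℕ)
    {σ T : ℝ} (hσ : 0 < σ) (hσ2 : σ < 2) (hT : 0 ≤ T) :
    TypeLE (tSliceDeriv F p z) (σ / (2 - σ)) (timeType σ T) ↔
      SeqLE (fun k => iteratedDeriv (2 * k) (iteratedDeriv p (F t₀)) z) (2 * (1 - 1 / σ))
        (derivRate σ T ^ 2 * 4 ^ (1 - 1 / σ)) := by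
  rw [hF.typeLE_tSliceDeriv_iff t₀ z p hσ hσ2 hT]
  simp only [iteratedDeriv_iteratedDeriv]

/-- If it failed, interpolating the order `σ₀` on a set of positive area with an order `σ₁` slightly
above `ρ` would give `F(t₀, ·)` an order below `ρ`. -/
lemma IsEntireCaloric.ae_not_typeLE_of_order (hF : IsEntireCaloric F) (t₀ : ℂ) (p : ℕ) {ρ σ₀ : ℝ}
    (hρ2 : ρ < 2) (hρ : entireOrder (F t₀) = ENNReal.ofReal ρ) (hσ₀ : 0 < σ₀) (hσρ : σ₀ < ρ) :
    ∀ᵐ z : ℂ, ¬ TypeLE (tSliceDeriv F p z) (σ₀ / (2 - σ₀)) 0 := by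
  by_contra hne
  have hρ0 : 0 < ρ := hσ₀.trans hσρ
  have hf := hF.entire_z t₀
  set g := iteratedDeriv p (F t₀)
  have hg : Differentiable ℂ g := differentiable_iteratedDeriv_of_entire hf p
  obtain ⟨θ, hθ0, hθ1, hθ⟩ := exists_interpolation hg (β₀ := 2 * (1 - 1 / σ₀)) one_pos
    -- The double negation makes `hne` literally the statement that `Z` is not null.
    (Z := {z | ¬ ¬ TypeLE (tSliceDeriv F p z) (σ₀ / (2 - σ₀)) 0}) (fun z hz => by
      have h1 := not_not.1 hz
      rw [← timeType_zero (hσρ.trans hρ2),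
        hF.typeLE_tSliceDeriv_iff' t₀ z p hσ₀ (hσρ.trans hρ2) le_rfl, derivRate_zero hσ₀] at h1
      exact h1 1 (by simp)) hne
  -- The exponents are affine in `1/σ`, so interpolation averages reciprocal orders; at `σ₁ = ρ` the
  -- inequality is strict, and it persists nearby.
  obtain ⟨σ₁, ⟨h1, h2⟩, h3⟩ : ∃ σ₁, (1 / ρ < θ / σ₀ + (1 - θ) / σ₁ ∧ σ₁ < 2) ∧ ρ < σ₁ := by
    have hc : ContinuousAt (fun x : ℝ => θ / σ₀ + (1 - θ) / x) ρ :=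
      continuousAt_const.add (continuousAt_const.div continuousAt_id hρ0.ne')
    have hlt : 1 / ρ < θ / σ₀ + (1 - θ) / ρ := by
      have : θ / ρ < θ / σ₀ := by gcongr
      have e : 1 / ρ = θ / ρ + (1 - θ) / ρ := by ring
      linarith
    have e1 := (hc.tendsto.eventually_const_lt hlt).and (eventually_lt_nhds hρ2)
    exact ((e1.filter_mono nhdsWithin_le_nhds).and
      (self_mem_nhdsWithin : Set.Ioi ρ ∈ 𝓝[>] ρ)).exists
  have hσ₁ : 0 < σ₁ := hρ0.trans h3
  have hg₁ : TypeLE g σ₁ 0 := (typeLE_iteratedDeriv_iff hf p hσ₁ le_rfl).2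
    ((CaloricGrowth.entireOrder_le_iff hf hρ0.le).1 hρ.le σ₁ h3)
  obtain ⟨C, hC0, hC⟩ := hθ (2 * (1 - 1 / σ₁)) 1 one_pos fun R hR =>
    hg₁.exists_norm_even_iteratedDeriv_le hg hσ₁ le_rfl hR (by rw [derivRate_zero hσ₁]; simp)
  set σ' := (θ / σ₀ + (1 - θ) / σ₁)⁻¹ with hσ'
  have hpos : 0 < θ / σ₀ + (1 - θ) / σ₁ := (by positivity : 0 < 1 / ρ).trans h1
  have hσ'0 : 0 < σ' := inv_pos.2 hpos
  have hσ'ρ : σ' < ρ := by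
    rw [hσ', inv_lt_comm₀ hpos hρ0, ← one_div]; exact h1
  -- The type whose rate of even derivatives is exactly `1`; only its finiteness matters.
  obtain ⟨T, hT, hTl⟩ := exists_derivRate_eq (l := √(1 / 4 ^ (1 - 1 / σ'))) hσ'0 (by positivity)
  have hg' : TypeLE g σ' T := by
    refine typeLE_of_even_bound hg hσ'0 hT one_pos hC0 (le_of_eq ?_) fun u hu k => ?_
    · rw [hTl, Real.sq_sqrt (by positivity)]; field_simp
    · refine (hC u hu k).trans_eq ?_
      congr 2
      · simp
      · have : 1 / σ' = θ / σ₀ + (1 - θ) / σ₁ := by rw [hσ', one_div, inv_inv]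
        rw [this]; ring
  have hf' := (typeLE_iteratedDeriv_iff hf p hσ'0 hT).1 hg'
  have := (CaloricGrowth.entireOrder_le_iff hf hσ'0.le).2 fun σ hσ => hf'.of_lt hσ'0 hT hσ
  rw [hρ, ENNReal.ofReal_le_ofReal_iff hσ'0.le] at this
  linarith

lemma IsEntireCaloric.ae_not_typeLE_of_type (hF : IsEntireCaloric F) (t₀ : ℂ) (p : ℕ) {ρ T S : ℝ}
    (hρ0 : 0 < ρ) (hρ2 : ρ < 2) (hρ : entireOrder (F t₀) = ENNReal.ofReal ρ)
    (hT : entireType (F t₀) = ENNReal.ofReal T) (hS : 0 ≤ S) (hST : S < T) :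
    ∀ᵐ z : ℂ, ¬ TypeLE (tSliceDeriv F p z) (ρ / (2 - ρ)) (timeType ρ S) := by
  by_contra hne
  have hT0 : 0 < T := hS.trans_lt hST
  have hf := hF.entire_z t₀
  set g := iteratedDeriv p (F t₀)
  have hg : Differentiable ℂ g := differentiable_iteratedDeriv_of_entire hf p
  set κ := derivRate ρ 1 ^ 2 * 4 ^ (1 - 1 / ρ) with hκ
  have hκ0 : 0 < κ := mul_pos (pow_pos (derivRate_pos hρ0 one_pos) 2) (by positivity)
  have hrate : ∀ x ≥ 0, derivRate ρ x ^ 2 * 4 ^ (1 - 1 / ρ) = κ * (x ^ (1 / ρ)) ^ 2 :=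
    fun x hx => by rw [derivRate_eq_mul_rpow hρ0 hx, hκ]; ring
  clear_value κ
  -- `S'` leaves room above the rate for `S` and is positive even when `S = 0`.
  obtain ⟨S', hSS', hS'T⟩ := exists_between hST
  have hS'0 : 0 < S' := hS.trans_lt hSS'
  obtain ⟨θ, hθ0, hθ1, hθ⟩ := exists_interpolation hg (β₀ := 2 * (1 - 1 / ρ))
    (ν₀ := κ * (S' ^ (1 / ρ)) ^ 2) (by positivity)
    (Z := {z | ¬ ¬ TypeLE (tSliceDeriv F p z) (ρ / (2 - ρ)) (timeType ρ S)}) (fun z hz => by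
      have h1 := not_not.1 hz
      rw [hF.typeLE_tSliceDeriv_iff' t₀ z p hρ0 hρ2 hS, hrate S hS] at h1
      exact h1 _ (by gcongr)) hne
  -- At equal orders interpolation takes the weighted geometric mean of the types; for `T₁` close to
  -- `T` it stays below `T`.
  obtain ⟨T₁, h1, h2⟩ : ∃ T₁, S' ^ θ * T₁ ^ (1 - θ) < T ∧ T < T₁ := by
    have hc : ContinuousAt (fun x : ℝ => S' ^ θ * x ^ (1 - θ)) T :=
      continuousAt_const.mul (Real.continuousAt_rpow_const _ _ (Or.inl hT0.ne'))
    have hlt : S' ^ θ * T ^ (1 - θ) < T := by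
      calc S' ^ θ * T ^ (1 - θ) < T ^ θ * T ^ (1 - θ) := by gcongr
        _ = T := by rw [← Real.rpow_add hT0, add_sub_cancel, Real.rpow_one]
    have e1 := hc.tendsto.eventually_lt_const hlt
    exact ((e1.filter_mono nhdsWithin_le_nhds).and
      (self_mem_nhdsWithin : Set.Ioi T ∈ 𝓝[>] T)).exists
  have hT₁ : 0 < T₁ := hT0.trans h2
  have hg₁ : TypeLE g ρ T := (typeLE_iteratedDeriv_iff hf p hρ0 hT0.le).2
    ((entireType_le_iff hf hρ0 hT0.le hρ).1 hT.le)
  obtain ⟨C, hC0, hC⟩ := hθ (2 * (1 - 1 / ρ)) (κ * (T₁ ^ (1 / ρ)) ^ 2) (by positivity) fun R hR =>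
    hg₁.exists_norm_even_iteratedDeriv_le hg hρ0 hT0.le hR (by
      rw [hrate T hT0.le]; gcongr)
  set T' := S' ^ θ * T₁ ^ (1 - θ) with hT'
  have hT'0 : 0 ≤ T' := by positivity
  have hpow : ∀ {x : ℝ} (a : ℝ), 0 < x → ((x ^ (1 / ρ)) ^ 2) ^ a = ((x ^ a) ^ (1 / ρ)) ^ 2 := by
    intro x a hx
    rw [← Real.rpow_natCast, ← Real.rpow_natCast, ← Real.rpow_mul hx.le, ← Real.rpow_mul hx.le,
      ← Real.rpow_mul hx.le, ← Real.rpow_mul hx.le]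
    congr 1; ring
  have hν : (κ * (S' ^ (1 / ρ)) ^ 2) ^ θ * (κ * (T₁ ^ (1 / ρ)) ^ 2) ^ (1 - θ) =
      derivRate ρ T' ^ 2 * 4 ^ (1 - 1 / ρ) := by
    rw [hrate T' hT'0, Real.mul_rpow hκ0.le (by positivity), Real.mul_rpow hκ0.le (by positivity),
      hpow θ hS'0, hpow (1 - θ) hT₁, hT',
      Real.mul_rpow (x := S' ^ θ) (by positivity) (by positivity)]
    have : κ ^ θ * κ ^ (1 - θ) = κ := by
      rw [← Real.rpow_add hκ0, add_sub_cancel, Real.rpow_one]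
    linear_combination ((S' ^ θ) ^ (1 / ρ)) ^ 2 * ((T₁ ^ (1 - θ)) ^ (1 / ρ)) ^ 2 * this
  have hg' : TypeLE g ρ T' := by
    refine typeLE_of_even_bound hg hρ0 hT'0 (by positivity) hC0 hν.le fun u hu k => ?_
    refine (hC u hu k).trans_eq ?_
    congr 2; ring
  have := (entireType_le_iff hf hρ0 hT'0 hρ).2 ((typeLE_iteratedDeriv_iff hf p hρ0 hT'0).1 hg')
  rw [hT, ENNReal.ofReal_le_ofReal_iff hT'0] at this
  linarith

/-- Rational orders below `ρ` suffice, so the exceptional set is a countable union of null sets. -/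
lemma IsEntireCaloric.ae_entireOrder_eq (hF : IsEntireCaloric F) (t₀ : ℂ) (p : ℕ) {ρ : ℝ}
    (hρ0 : 0 < ρ) (hρ2 : ρ < 2) (hρ : entireOrder (F t₀) = ENNReal.ofReal ρ)
    (hle : ∀ z, entireOrder (tSliceDeriv F p z) ≤ ENNReal.ofReal (ρ / (2 - ρ))) :
    ∀ᵐ z : ℂ, entireOrder (tSliceDeriv F p z) = ENNReal.ofReal (ρ / (2 - ρ)) := by
  have hae : ∀ᵐ z : ℂ, ∀ q : ℚ, 0 < (q : ℝ) → (q : ℝ) < ρ →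
      ¬ TypeLE (tSliceDeriv F p z) (q / (2 - q)) 0 := by
    refine ae_all_iff.2 fun q => ?_
    by_cases hq : 0 < (q : ℝ) ∧ (q : ℝ) < ρ
    · filter_upwards [hF.ae_not_typeLE_of_order t₀ p hρ2 hρ hq.1 hq.2] with z hz _ _ using hz
    · exact Eventually.of_forall fun z h1 h2 => absurd ⟨h1, h2⟩ hq
  filter_upwards [hae] with z hz
  refine le_antisymm (hle z) ?_
  by_contra! hlt
  have h2 : 0 < 2 - ρ := by linarith
  obtain ⟨x, hx⟩ : ∃ x : NNReal, entireOrder (tSliceDeriv F p z) = x :=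
    ⟨_, (ENNReal.coe_toNNReal hlt.ne_top).symm⟩
  rw [hx, ← ENNReal.ofReal_coe_nnreal, ENNReal.ofReal_lt_ofReal_iff (by positivity)] at hlt
  obtain ⟨b, hxb, hbs⟩ := exists_between hlt
  obtain ⟨σ, hσ0, hσ2, rfl⟩ := exists_timeOrder_eq (x.2.trans_lt hxb)
  have hσρ : σ < ρ := by
    by_contra! h
    rcases h.eq_or_lt with rfl | h
    · exact lt_irrefl _ hbs
    · exact lt_asymm hbs (timeOrder_lt h hσ2)
  obtain ⟨q, hq1, hq2⟩ := exists_rat_btwn hσρ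
  refine hz q (hσ0.trans hq1) hq2 ((CaloricGrowth.entireOrder_le_iff
    (hF.differentiable_tSliceDeriv p z) x.2).1 ?_ _
    (hxb.trans (timeOrder_lt hq1 (hq2.trans hρ2))))
  rw [hx, ← ENNReal.ofReal_coe_nnreal]
  rfl

lemma exists_timeType_eq {ρ y : ℝ} (hρ0 : 0 < ρ) (hρ2 : ρ < 2) (hy : 0 ≤ y) :
    ∃ T ≥ 0, timeType ρ T = y := by
  have h2 : 0 < 2 - ρ := by linarith
  have h1 : 0 < 1 - ρ / 2 := by linarith
  set c := (1 - ρ / 2) * (2 * ρ) ^ (ρ / (2 - ρ)) with hc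
  have hc0 : 0 < c := by positivity
  refine ⟨(y / c) ^ ((2 - ρ) / 2), by positivity, ?_⟩
  rw [timeType, ← hc, ← Real.rpow_mul (by positivity),
    show (2 - ρ) / 2 * (2 / (2 - ρ)) = 1 by field_simp, Real.rpow_one]
  field_simp

lemma timeType_mono {ρ S T : ℝ} (hρ0 : 0 < ρ) (hρ2 : ρ < 2) (hS : 0 ≤ S) (h : S ≤ T) :
    timeType ρ S ≤ timeType ρ T := by
  have h2 : 0 < 2 - ρ := by linarith
  have h1 : 0 < 1 - ρ / 2 := by linarith
  unfold timeType
  gcongr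

lemma ofReal_timeType {ρ T : ℝ} (hρ0 : 0 < ρ) (hρ2 : ρ < 2) (hT : 0 ≤ T) :
    ENNReal.ofReal (timeType ρ T) = ENNReal.ofReal ((1 - ρ / 2) * (2 * ρ) ^ (ρ / (2 - ρ))) *
      ENNReal.ofReal T ^ (2 / (2 - ρ)) := by
  have h2 : 0 < 2 - ρ := by linarith
  have h1 : 0 < 1 - ρ / 2 := by linarith
  rw [timeType, ENNReal.ofReal_mul (by positivity),
    ENNReal.ofReal_rpow_of_nonneg hT (by positivity)]

/-- An element of `[0, ∞]` is determined by its finite upper bounds, and `timeType ρ` maps `[0, ∞)`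
onto itself; this also covers infinite type. -/
lemma eq_timeType_of_forall_le_iff {ρ : ℝ} (hρ0 : 0 < ρ) (hρ2 : ρ < 2) {X τ : ℝ≥0∞}
    (h : ∀ T ≥ 0, X ≤ ENNReal.ofReal (timeType ρ T) ↔ τ ≤ ENNReal.ofReal T) :
    X = ENNReal.ofReal ((1 - ρ / 2) * (2 * ρ) ^ (ρ / (2 - ρ))) * τ ^ (2 / (2 - ρ)) := by
  have h2 : 0 < 2 - ρ := by linarith
  have h1 : 0 < 1 - ρ / 2 := by linarith
  refine le_antisymm ?_ ?_
  · rcases eq_or_ne τ ⊤ with rfl | hτ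
    · rw [ENNReal.top_rpow_of_pos (by positivity), ENNReal.mul_top]
      · exact le_top
      · exact (ENNReal.ofReal_pos.2 (by positivity)).ne'
    · have := (h τ.toReal ENNReal.toReal_nonneg).2 (ENNReal.ofReal_toReal hτ).ge
      rwa [ofReal_timeType hρ0 hρ2 ENNReal.toReal_nonneg, ENNReal.ofReal_toReal hτ] at this
  · rcases eq_or_ne X ⊤ with rfl | hX
    · exact le_top
    · obtain ⟨T, hT, hTX⟩ := exists_timeType_eq hρ0 hρ2 (ENNReal.toReal_nonneg (a := X))
      have e : X = ENNReal.ofReal (timeType ρ T) := by rw [hTX, ENNReal.ofReal_toReal hX]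
      have := (h T hT).1 e.le
      rw [e, ofReal_timeType hρ0 hρ2 hT]
      gcongr

lemma IsEntireCaloric.ae_entireType_eq (hF : IsEntireCaloric F) (t₀ : ℂ) (p : ℕ) {ρ T : ℝ}
    (hρ0 : 0 < ρ) (hρ2 : ρ < 2) (hρ : entireOrder (F t₀) = ENNReal.ofReal ρ)
    (hT0 : 0 ≤ T) (hT : entireType (F t₀) = ENNReal.ofReal T)
    (ho : ∀ᵐ z : ℂ, entireOrder (tSliceDeriv F p z) = ENNReal.ofReal (ρ / (2 - ρ)))
    (hle : ∀ᵐ z : ℂ, entireType (tSliceDeriv F p z) ≤ ENNReal.ofReal (timeType ρ T)) :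
    ∀ᵐ z : ℂ, entireType (tSliceDeriv F p z) = ENNReal.ofReal (timeType ρ T) := by
  have h2 : 0 < 2 - ρ := by linarith
  have hae : ∀ᵐ z : ℂ, ∀ q : ℚ, 0 ≤ (q : ℝ) → (q : ℝ) < T →
      ¬ TypeLE (tSliceDeriv F p z) (ρ / (2 - ρ)) (timeType ρ q) := by
    refine ae_all_iff.2 fun q => ?_
    by_cases hq : 0 ≤ (q : ℝ) ∧ (q : ℝ) < T
    · filter_upwards [hF.ae_not_typeLE_of_type t₀ p hρ0 hρ2 hρ hT hq.1 hq.2] with z hz _ _ using hz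
    · exact Eventually.of_forall fun z h1 h2 => absurd ⟨h1, h2⟩ hq
  filter_upwards [hae, ho, hle] with z hz ho hle
  refine le_antisymm hle ?_
  by_contra! hlt
  obtain ⟨S, hS, hSX⟩ := exists_timeType_eq hρ0 hρ2
    (ENNReal.toReal_nonneg (a := entireType (tSliceDeriv F p z)))
  have e : entireType (tSliceDeriv F p z) = ENNReal.ofReal (timeType ρ S) := by
    rw [hSX, ENNReal.ofReal_toReal hlt.ne_top]
  have hST : S < T := by
    by_contra! h
    rw [e] at hlt
    exact hlt.not_ge (ENNReal.ofReal_le_ofReal (timeType_mono hρ0 hρ2 hT0 h))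
  obtain ⟨q, hq1, hq2⟩ := exists_rat_btwn hST
  have hq0 : (0 : ℝ) ≤ q := hS.trans hq1.le
  refine hz q hq0 hq2 ((entireType_le_iff (hF.differentiable_tSliceDeriv p z) (by positivity)
    (timeType_nonneg hρ0 hρ2 hq0) ho).1 ?_)
  rw [e]
  exact ENNReal.ofReal_le_ofReal (timeType_mono hρ0 hρ2 hS hq1.le)

end Caloric

end CaloricGrowth

end

theorem theorem5 (F : ℂ → ℂ → ℂ) (hF : CaloricGrowth.IsEntireCaloric F)
    -- the order `ρ` and the type `τ` of `F(t₀, ·)`, for any one `t₀`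
    (t₀ : ℂ) (ρ : ℝ) (τ : ℝ≥0∞) (hρ0 : 0 < ρ) (hρ2 : ρ < 2)
    (hρ : CaloricGrowth.entireOrder (fun z : ℂ => F t₀ z) = ENNReal.ofReal ρ)
    (hτ : CaloricGrowth.entireType (fun z : ℂ => F t₀ z) = τ) :
    -- the caloric `t`-order does not depend on `z`, it is positive and finite,
    -- and the sets on which the `t`-orders are maximal have full measure
    (∀ z : ℂ, CaloricGrowth.caloricTOrder F z = ENNReal.ofReal (ρ / (2 - ρ))) ∧
    (∀ᵐ z : ℂ, z ∈ CaloricGrowth.E0 F) ∧ (∀ᵐ z : ℂ, z ∈ CaloricGrowth.E1 F) ∧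
    ∃ τt : ℝ≥0∞,
      -- (i)
      (∀ z ∈ CaloricGrowth.E0 F ∩ CaloricGrowth.E1 F,
        max (CaloricGrowth.entireType (CaloricGrowth.tSlice F z))
          (CaloricGrowth.entireType (CaloricGrowth.tSliceDz F z)) = τt) ∧
      τt = ENNReal.ofReal ((1 - ρ / 2) * (2 * ρ) ^ (ρ / (2 - ρ))) * τ ^ (2 / (2 - ρ)) ∧
      (τt = 0 ↔ τ = 0) ∧ (τt = ∞ ↔ τ = ∞) ∧
      -- (ii)
      (τt < ∞ →
        (∀ᵐ z : ℂ, CaloricGrowth.entireType (CaloricGrowth.tSlice F z) = τt) ∧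
        (∀ᵐ z : ℂ, CaloricGrowth.entireType (CaloricGrowth.tSliceDz F z) = τt)) := by
  have h2 : 0 < 2 - ρ := by linarith
  have h1 : 0 < 1 - ρ / 2 := by linarith
  have hs : 0 < ρ / (2 - ρ) := by positivity
  have hexp : 0 < 2 / (2 - ρ) := by positivity
  have hc : 0 < ENNReal.ofReal ((1 - ρ / 2) * (2 * ρ) ^ (ρ / (2 - ρ))) :=
    ENNReal.ofReal_pos.2 (by positivity)
  have hord : ∀ z, CaloricGrowth.caloricTOrder F z = ENNReal.ofReal (ρ / (2 - ρ)) :=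
    fun z => hF.caloricTOrder_eq_ofReal t₀ z hρ0 hρ2 hρ
  have hmax := fun z => (CaloricGrowth.caloricTOrder_eq F z).symm.trans (hord z)
  have hae0 := hF.ae_entireOrder_eq t₀ 0 hρ0 hρ2 hρ fun z => (le_max_left _ _).trans_eq (hmax z)
  have hae1 := hF.ae_entireOrder_eq t₀ 1 hρ0 hρ2 hρ fun z => (le_max_right _ _).trans_eq (hmax z)
  have htype : ∀ z, CaloricGrowth.entireOrder (CaloricGrowth.tSliceDeriv F 0 z) =
        ENNReal.ofReal (ρ / (2 - ρ)) →
      CaloricGrowth.entireOrder (CaloricGrowth.tSliceDeriv F 1 z) =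
        ENNReal.ofReal (ρ / (2 - ρ)) →
      max (CaloricGrowth.entireType (CaloricGrowth.tSliceDeriv F 0 z))
        (CaloricGrowth.entireType (CaloricGrowth.tSliceDeriv F 1 z)) =
        ENNReal.ofReal ((1 - ρ / 2) * (2 * ρ) ^ (ρ / (2 - ρ))) * τ ^ (2 / (2 - ρ)) := by
    intro z hz0 hz1
    refine CaloricGrowth.eq_timeType_of_forall_le_iff hρ0 hρ2 fun T hT => ?_
    have hT' := CaloricGrowth.timeType_nonneg hρ0 hρ2 hT
    rw [max_le_iff,
      CaloricGrowth.entireType_le_iff (hF.differentiable_tSliceDeriv 0 z) hs hT' hz0,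
      CaloricGrowth.entireType_le_iff (hF.differentiable_tSliceDeriv 1 z) hs hT' hz1,
      ← hτ, CaloricGrowth.entireType_le_iff (hF.entire_z t₀) hρ0 hT hρ]
    exact (hF.typeLE_iff t₀ z hρ0 hρ2 hT).symm
  simp only [CaloricGrowth.E0, CaloricGrowth.E1, Set.mem_ofPred_eq, Set.mem_inter_iff, hord,
    ← CaloricGrowth.tSliceDeriv_zero, ← CaloricGrowth.tSliceDeriv_one]
  refine ⟨fun _ => trivial, hae0, hae1, _, fun z hz => htype z hz.1 hz.2, rfl, ?_, ?_, fun hfin => ?_⟩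
  · simp [hc.ne', ENNReal.rpow_eq_zero_iff, hexp, hexp.not_gt]
  · simp [ENNReal.mul_eq_top, hc.ne', ENNReal.rpow_eq_top_iff, hexp, hexp.not_gt]
  · have hτfin : τ ≠ ∞ := by
      rintro rfl
      rw [ENNReal.top_rpow_of_pos hexp, ENNReal.mul_top hc.ne'] at hfin
      exact lt_irrefl _ hfin
    have hT0 : 0 ≤ τ.toReal := ENNReal.toReal_nonneg
    have hT : CaloricGrowth.entireType (F t₀) = ENNReal.ofReal τ.toReal := by
      rw [ENNReal.ofReal_toReal hτfin]; exact hτ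
    have e := CaloricGrowth.ofReal_timeType hρ0 hρ2 hT0
    rw [ENNReal.ofReal_toReal hτfin] at e
    rw [← e] at htype ⊢
    refine ⟨hF.ae_entireType_eq t₀ 0 hρ0 hρ2 hρ hT0 hT hae0 ?_,
      hF.ae_entireType_eq t₀ 1 hρ0 hρ2 hρ hT0 hT hae1 ?_⟩
    · filter_upwards [hae0, hae1] with z hz0 hz1
      exact (le_max_left _ _).trans_eq (htype z hz0 hz1)
    · filter_upwards [hae0, hae1] with z hz0 hz1
      exact (le_max_right _ _).trans_eq (htype z hz0 hz1)
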